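/- Let $d\ge 1$ and let $H<\mathrm{GL}(d,\mathbb R)$ be a closed subgroup with left Haar measure $dh$. Let $G=\mathbb R^d\rtimes H$, with left Haar measure $|\det h|^{-1}\,dx\,dh$, act on $L^2(\mathbb R^d)$ by the quasi-regular representation $[\pi(x,h)f](y)=|\det h|^{-1/2}f(h^{-1}(y-x))$. A nonzero $\psi\in L^2(\mathbb R^d)$ is called admissible if $(x,h)\mapsto\langle\psi,\pi(x,h)\psi\rangle$ belongs to $L^2(G)$. Assume that $\pi$ is irreducible and square-integrable, i.e. that $\pi$ has no closed invariant subspaces except $\{0\}$ and $L^2(\mathbb R^d)$ and that admissible vectors exist. Let $\mathcal O\subset\mathbb R^d$ be the open dual orbit, i.e. the open orbit of the action $\xi\mapsto h^T\xi$ of $H$, let $\mathcal O^c$ be its complement, and put $$A(\xi)=\min\left(\frac{\mathrm{dist}(\xi,\mathcal O^c)}{1+\sqrt{|\xi|^2-\mathrm{dist}(\xi,\mathcal O^c)^2}},\ \frac1{1+|\xi|}\right),$$ where $|\cdot|$ is the euclidean norm; $\|\cdot\|$ denotes the corresponding operator norm on matrices. Assume that $\mathcal O$ is $(0,2,1)$-temperately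 embedded with index $\ell\in\mathbb N_0$, i.e. for some $\xi_0\in\mathcal O$ the function $h\mapsto(1+\|h\|)^{d+1}A(h^T\xi_0)^\ell$ is in $L^2(H)$ and the function $h\mapsto|\det h|^{-1}(1+\|h\|)^{d+1}A(h^{-T}\xi_0)^\ell$ is in $L^1(H)$. 1. Let $t\in\mathbb N$ with $t>\ell+d/2+1$, and let $\psi\in L^1(\mathbb R^d)$ be nonzero, with Fourier transform $\widehat\psi(\xi)=\int\psi(x)e^{-2\pi i\langle x,\xi\rangle}dx$. Suppose that $\psi$ has vanishing moments in $\mathcal O^c$ of order $t$, i.e. all distributional derivatives $\partial^\alpha\widehat\psi$ with $|\alpha|\le t$ are continuous functions and those with $|\alpha|<t$ vanish identically on $\mathcal O^c$. Suppose also that $$|\widehat\psi|_{t,t}=\sup_{\xi\in\mathbb R^d,\ |\alpha|\le t}(1+|\xi|)^t|\partial^\alpha\widehat\psi(\xi)|<\infty.$$ Then $\psi\in L^2(\mathbb R^d)$, and $\psi$ is admissible. 2. There exist admissible vectors in $C_c^\infty(\mathbb R^d)$. -/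

import Mathlib

open MeasureTheory Matrix FourierTransform
open scoped ContDiff ENNReal

noncomputable section

namespace Wavelet

/-- Euclidean space `ℝ^d`. -/
abbrev E (d : ℕ) : Type := EuclideanSpace ℝ (Fin d)

/-- The Hilbert space `L²(ℝ^d)` of complex-valued functions. -/
abbrev L2 (d : ℕ) : Type := Lp ℂ 2 (volume : Measure (E d))

variable {d : ℕ}

/-- The action `x ↦ A x` of a real matrix on `ℝ^d`. -/
def act (A : Matrix (Fin d) (Fin d) ℝ) (x : E d) : E d := Matrix.toEuclideanLin A x

/-- The determinant of an invertible matrix, as a real number. -/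
def rdet (h : GL (Fin d) ℝ) : ℝ := (h : Matrix (Fin d) (Fin d) ℝ).det

/-- The operator norm of `h` on `(ℝ^d, |·|)`, `|·|` being the euclidean norm. -/
def opNorm (h : GL (Fin d) ℝ) : ℝ :=
  ‖Matrix.toEuclideanCLM (n := Fin d) (𝕜 := ℝ) (h : Matrix (Fin d) (Fin d) ℝ)‖

/-! ### The quasi-regular representation of `G = ℝ^d ⋊ H` -/

/-- `[π(x,h) f](y) = |det h|^{-1/2} f (h⁻¹ (y - x))`, on functions. -/
def quasiRegularFun (x : E d) (h : GL (Fin d) ℝ) (f : E d → ℂ) : E d → ℂ :=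
  fun y => ((|rdet h| ^ (-(1 / 2) : ℝ) : ℝ) : ℂ) *
    f (act ((h⁻¹ : GL (Fin d) ℝ) : Matrix (Fin d) (Fin d) ℝ) (y - x))

theorem memLp_quasiRegularFun (x : E d) (h : GL (Fin d) ℝ) {f : E d → ℂ}
    (hf : MemLp f 2 volume) : MemLp (quasiRegularFun x h f) 2 volume := by
  unfold quasiRegularFun
  refine MemLp.const_mul ?_ _
  set B : Matrix (Fin d) (Fin d) ℝ := ((h⁻¹ : GL (Fin d) ℝ) : Matrix (Fin d) (Fin d) ℝ) with hB
  set L : E d →ₗ[ℝ] E d := Matrix.toEuclideanLin B with hL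
  have hdet : LinearMap.det L ≠ 0 := by
    have h1 : LinearMap.det L = B.det := by
      rw [hL, Matrix.toEuclideanLin_eq_toLin_orthonormal, LinearMap.det_toLin]
    rw [h1, hB]
    exact ((Matrix.isUnit_iff_isUnit_det _).1 (h⁻¹).isUnit).ne_zero
  have hLm : Measurable L := L.continuous_of_finiteDimensional.measurable
  have hg : MemLp (fun y : E d => f (L y)) 2 volume := by
    refine MemLp.comp_of_map (f := L) (g := f) ?_ hLm.aemeasurable
    rw [Measure.map_linearMap_addHaar_eq_smul_addHaar volume hdet]
    exact hf.smul_measure ENNReal.ofReal_ne_top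
  exact hg.comp_measurePreserving (measurePreserving_sub_right volume x)

/-- The operator `π(x,h)` on `L²(ℝ^d)`. -/
def quasiRegular (x : E d) (h : GL (Fin d) ℝ) (f : L2 d) : L2 d :=
  (memLp_quasiRegularFun x h (Lp.memLp f)).toLp _

/-- `π` is irreducible: the only closed invariant subspaces of `L²(ℝ^d)` are the trivial ones. -/
def IsIrreducibleRep (H : Subgroup (GL (Fin d) ℝ)) : Prop :=
  ∀ K : Submodule ℂ (L2 d), IsClosed (K : Set (L2 d)) →
    (∀ (x : E d) (h : H), ∀ f ∈ K, quasiRegular x (h : GL (Fin d) ℝ) f ∈ K) → K = ⊥ ∨ K = ⊤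

/-- The left Haar measure `d(x,h) = |det h|⁻¹ dx dh` of `G = ℝ^d ⋊ H`,
where `dh = μ` is a left Haar measure of `H`. -/
def haarG (H : Subgroup (GL (Fin d) ℝ)) [MeasurableSpace H] (μ : Measure H) :
    Measure (E d × H) :=
  ((volume : Measure (E d)).prod μ).withDensity
    (fun p => ENNReal.ofReal (|rdet (p.2 : GL (Fin d) ℝ)|⁻¹))

/-- The wavelet transform `(x,h) ↦ ⟨f, π(x,h) ψ⟩`, the scalar product being linear in the first
argument (Mathlib's `inner` is linear in the second one). -/
def waveletTransform (H : Subgroup (GL (Fin d) ℝ)) (ψ f : L2 d) : E d × H → ℂ :=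
  fun p => inner ℂ (quasiRegular p.1 (p.2 : GL (Fin d) ℝ) ψ) f

/-- Admissible vectors: nonzero `ψ ∈ L²(ℝ^d)` such that `(x,h) ↦ ⟨ψ, π(x,h) ψ⟩` is in `L²(G)`. -/
def IsAdmissibleVector (H : Subgroup (GL (Fin d) ℝ)) [MeasurableSpace H] (μ : Measure H)
    (ψ : L2 d) : Prop :=
  ψ ≠ 0 ∧ MemLp (waveletTransform H ψ ψ) 2 (haarG H μ)

/-- The function `ψ` is (square-integrable and represents) an admissible vector. -/
def IsAdmissibleFun (H : Subgroup (GL (Fin d) ℝ)) [MeasurableSpace H] (μ : Measure H)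
    (ψ : E d → ℂ) : Prop :=
  ∃ hψ : MemLp ψ 2 volume, IsAdmissibleVector H μ (hψ.toLp ψ)

/-- Admissible dilation groups: closed subgroups `H` of `GL(d,ℝ)` whose quasi-regular
representation is irreducible and square-integrable. -/
structure IsAdmissibleDilationGroup (H : Subgroup (GL (Fin d) ℝ)) [MeasurableSpace H]
    (μ : Measure H) : Prop where
  closed : IsClosed (H : Set (GL (Fin d) ℝ))
  irreducible : IsIrreducibleRep H
  squareIntegrable : ∃ ψ : L2 d, IsAdmissibleVector H μ ψ

/-! ### The open dual orbit -/

/-- The dual action `ξ ↦ h^T ξ`. -/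
def dualAct (h : GL (Fin d) ℝ) (ξ : E d) : E d :=
  act ((h : Matrix (Fin d) (Fin d) ℝ)ᵀ) ξ

/-- `O` is an open orbit of the dual action of `H`. -/
def IsOpenDualOrbit (H : Subgroup (GL (Fin d) ℝ)) (O : Set (E d)) : Prop :=
  IsOpen O ∧ ∃ ξ₀ : E d, O = Set.range (fun h : H => dualAct (h : GL (Fin d) ℝ) ξ₀)

/-- The auxiliary function
`A(ξ) = min (dist(ξ,Oᶜ) / (1 + √(|ξ|² - dist(ξ,Oᶜ)²))) (1 / (1 + |ξ|))`. -/
def auxA (O : Set (E d)) (ξ : E d) : ℝ :=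
  min (Metric.infDist ξ Oᶜ / (1 + Real.sqrt (‖ξ‖ ^ 2 - Metric.infDist ξ Oᶜ ^ 2)))
    (1 / (1 + ‖ξ‖))

/-- `O` is `(s,q,w)`-temperately embedded with index `ℓ` (for `s ≥ 0`, `1 ≤ q < ∞` and a weight
`w` on `H`). -/
def TemperatelyEmbedded (H : Subgroup (GL (Fin d) ℝ)) [MeasurableSpace H] (μ : Measure H)
    (O : Set (E d)) (s q : ℝ) (w : H → ℝ) (ℓ : ℕ) : Prop :=
  ∃ ξ₀ ∈ O,
    MemLp (fun h : H => |rdet (h : GL (Fin d) ℝ)| ^ (1 / 2 - 1 / q : ℝ) *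
      (1 + opNorm (h : GL (Fin d) ℝ)) ^ (s + d + 1 : ℝ) * w h *
      auxA O (dualAct (h : GL (Fin d) ℝ) ξ₀) ^ ℓ) (ENNReal.ofReal q) μ ∧
    MemLp (fun h : H => |rdet (h : GL (Fin d) ℝ)| ^ (-(1 / 2) - 1 / q : ℝ) *
      (1 + opNorm (h : GL (Fin d) ℝ)) ^ (s + d + 1 : ℝ) * w h *
      auxA O (dualAct ((h : GL (Fin d) ℝ)⁻¹) ξ₀) ^ ℓ) 1 μ

/-! ### Derivatives, Schwartz norms and vanishing moments -/

/-- The partial derivative `∂_{v 0} ⋯ ∂_{v (n-1)} f` of order `n`. As partial derivatives of a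
`C^n` function commute, the `∂^α f` with `|α| = n` are exactly these, for `v : Fin n → Fin d`. -/
def partialDeriv {n : ℕ} (v : Fin n → Fin d) (f : E d → ℂ) (x : E d) : ℂ :=
  iteratedFDeriv ℝ n f x (fun j => EuclideanSpace.single (v j) (1 : ℝ))

/-- The function `g` is the distributional derivative `∂_{v 0} ⋯ ∂_{v (n-1)} f`. -/
def IsDistribDeriv {n : ℕ} (v : Fin n → Fin d) (f g : E d → ℂ) : Prop :=
  ∀ φ : E d → ℂ, ContDiff ℝ ∞ φ → HasCompactSupport φ →
    ∫ ξ, f ξ * partialDeriv v φ ξ = (-1) ^ n * ∫ ξ, g ξ * φ ξ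

/-- The Schwartz norm `|f|_{r,m} = sup_{x, |α| ≤ r} (1 + |x|)^m |∂^α f(x)|`, with values in
`[0,∞]`. -/
def schwartzNorm (r m : ℕ) (f : E d → ℂ) : ℝ≥0∞ :=
  ⨆ (n : ℕ) (_ : n ≤ r) (v : Fin n → Fin d) (x : E d),
    ENNReal.ofReal ((1 + ‖x‖) ^ m * ‖partialDeriv v f x‖)

/-- `f ∈ L¹(ℝ^d)` has vanishing moments in `Oᶜ` of order `r`: all distributional derivatives
of its Fourier transform of order at most `r` are continuous functions, and those of order less
than `r` vanish identically on `Oᶜ`. -/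
def HasVanishingMoments (O : Set (E d)) (r : ℕ) (f : E d → ℂ) : Prop :=
  Integrable f volume ∧
    ∀ n ≤ r, ∀ v : Fin n → Fin d, ∃ g : E d → ℂ, Continuous g ∧ IsDistribDeriv v (𝓕 f) g ∧
      (n < r → ∀ ξ ∈ Oᶜ, g ξ = 0)

end Wavelet

end

/-! For fixed `h` the function `x ↦ ⟨ψ, π(x,h)ψ⟩` is the inverse Fourier transform of `|det h|^{1/2}
ψ^(ξ) conj ψ^(h^T ξ)`. By Plancherel and Tonelli its squared norm in `L²(G)` is `∫ |ψ^(ξ)|² ∫_H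
|ψ^(h^T ξ)|² dh dξ`, since the density `|det h|⁻¹` cancels the determinant. Left invariance makes
the inner integral constant on `O`, and `Oᶜ` is a null set. So a nonzero `ψ ∈ L¹ ∩ L²` is admissible
as soon as `∫_H |ψ^(h^T ξ₀)|² dh < ∞` for one `ξ₀ ∈ O` (`isAdmissibleFun_of_lintegral_lt_top`).
Temperate embedding puts `h ↦ A(h^T ξ₀)^ℓ` in `L²(H)`, so in both parts it suffices to prove `|ψ^| ≤
C A^ℓ`.

Irreducibility enters through `volume_compl_eq_zero`: an invariant open nonempty set has null
complement, because otherwise the functions with spectrum outside it would give a nontrivial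
invariant subspace. Hence the open orbit is unique, and as scalars commute with `H`, its complement
is a cone.

For part 1, continuous distributional derivatives are classical ones. Let `η` be a point of `Oᶜ`
nearest to `ξ`. The cone property gives `η ⊥ ξ - η`, so the square root in `A` is `|η|` and every
point of the segment from `η` to `ξ` has norm at least `|η|`. Taylor expansion at `η` together with
the Schwartz bound gives `|ψ^(ξ)| ≤ C (dist / (1 + |η|))^t`. The other term of the minimum is plain
decay, and `A^t ≤ A^ℓ` because `A ≤ 1`.

For part 2, one needs a polynomial `q` that vanishes on `Oᶜ` but not identically. If `X₁, …, X_d` in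
the Lie algebra of `H` map `ξ₀ ∈ O` to a basis, take for `q(η)` the determinant with rows `X_iᵀ η`.
Where it is nonzero the orbit of `η` is open, hence equal to `O`. Such `X_i` exist because an orbit
with interior points has full tangent space (`exists_mem_lieAlg_apply_eq`). Then `q^ℓ φ^` with a
bump function `φ` is the Fourier transform of a derivative of `φ`, so of a function in `C_c^∞`, and
it is `O(A^ℓ)` because `φ^` decays rapidly. -/

namespace Wavelet

/-! ### Fourier transform and Plancherel on `L¹ ∩ L²`; linear changes of variables. -/

open SchwartzMap

variable {d : ℕ}

/-- Locally integrable functions are determined by their integrals against Schwartz functions. -/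
theorem ae_eq_of_integral_schwartz {f g : E d → ℂ} (hf : LocallyIntegrable f volume)
    (hg : LocallyIntegrable g volume)
    (h : ∀ φ : 𝓢(E d, ℂ), ∫ x, φ x • f x = ∫ x, φ x • g x) : f =ᵐ[volume] g := by
  refine ae_eq_of_integral_contDiff_smul_eq hf hg fun φ hφ hc => ?_
  have h1 : HasCompactSupport (fun x => (φ x : ℂ)) := hc.comp_left Complex.ofReal_zero
  have h2 : ContDiff ℝ ∞ (fun x => (φ x : ℂ)) := Complex.ofRealCLM.contDiff.comp hφ
  simpa using h (h1.toSchwartzMap h2)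

/-- The multiplication formula for an integrable function and a Schwartz function. -/
theorem integral_fourier_schwartz_smul {f : E d → ℂ} (hf : Integrable f volume)
    (φ : 𝓢(E d, ℂ)) : ∫ x, (𝓕 φ) x • f x = ∫ x, φ x • (𝓕 f) x := by
  have h := VectorFourier.integral_fourierIntegral_smul_eq_flip (L := innerₗ (E d))
    (μ := volume) (ν := volume) Real.continuous_fourierChar continuous_inner φ.integrable hf
  rw [flip_innerₗ] at h
  exact h

/-- The `L²` transform is compatible with that of tempered distributions, so it obeys the same
multiplication formula as the Fourier integral. This is what allows the two transforms to be
compared by testing. -/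
theorem integral_schwartz_smul_fourier_L2 (f : L2 d) (φ : 𝓢(E d, ℂ)) :
    ∫ x, φ x • (𝓕 f : L2 d) x = ∫ x, (𝓕 φ) x • f x := by
  have h := congrArg (fun T : TemperedDistribution (E d) ℂ => T φ)
    (Lp.fourier_toTemperedDistribution_eq f)
  simp only [TemperedDistribution.fourier_apply, Lp.toTemperedDistribution_apply] at h
  exact h.symm

theorem continuous_fourier {f : E d → ℂ} (hf : Integrable f volume) : Continuous (𝓕 f) :=
  VectorFourier.fourierIntegral_continuous Real.continuous_fourierChar
    (by exact continuous_inner) hf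

theorem locallyIntegrable_L2 (f : L2 d) : LocallyIntegrable f volume :=
  (Lp.memLp f).locallyIntegrable (by norm_num)

/-- On `L¹ ∩ L²` the `L²` Fourier transform is given by the Fourier integral. -/
theorem fourier_toLp_ae {f : E d → ℂ} (hf : Integrable f volume) (hf2 : MemLp f 2 volume) :
    (𝓕 (hf2.toLp f) : L2 d) =ᵐ[volume] 𝓕 f := by
  refine ae_eq_of_integral_schwartz (locallyIntegrable_L2 _)
    (continuous_fourier hf).locallyIntegrable fun φ => ?_
  rw [integral_schwartz_smul_fourier_L2, ← integral_fourier_schwartz_smul hf]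
  refine integral_congr_ae ?_
  filter_upwards [hf2.coeFn_toLp] with x hx
  rw [hx]

/-- Plancherel's theorem on `L¹ ∩ L²`. -/
theorem memLp_fourier {f : E d → ℂ} (hf : Integrable f volume) (hf2 : MemLp f 2 volume) :
    MemLp (𝓕 f) 2 volume :=
  (memLp_congr_ae (fourier_toLp_ae hf hf2)).1 (Lp.memLp _)

theorem eLpNorm_fourier {f : E d → ℂ} (hf : Integrable f volume) (hf2 : MemLp f 2 volume) :
    eLpNorm (𝓕 f) 2 volume = eLpNorm f 2 volume := by
  rw [← eLpNorm_congr_ae (fourier_toLp_ae hf hf2), ← eLpNorm_congr_ae hf2.coeFn_toLp,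
    ← Lp.enorm_def, ← Lp.enorm_def, enorm_eq_iff_norm_eq, Lp.norm_fourier_eq]

/-- Parseval's identity on `L¹ ∩ L²`. -/
theorem integral_conj_fourier_mul_fourier {f g : E d → ℂ} (hf : Integrable f volume)
    (hf2 : MemLp f 2 volume) (hg : Integrable g volume) (hg2 : MemLp g 2 volume) :
    ∫ ξ, 𝓕 g ξ * star (𝓕 f ξ) = ∫ x, g x * star (f x) := by
  have h := Lp.inner_fourier_eq (hf2.toLp f) (hg2.toLp g)
  rw [L2.inner_def, L2.inner_def] at h
  refine Eq.trans ?_ (h.trans ?_)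
  · refine integral_congr_ae ?_
    filter_upwards [fourier_toLp_ae hf hf2, fourier_toLp_ae hg hg2] with ξ h1 h2
    simp [h1, h2, RCLike.inner_apply]
  · refine integral_congr_ae ?_
    filter_upwards [hf2.coeFn_toLp, hg2.coeFn_toLp] with ξ h1 h2
    simp [h1, h2, RCLike.inner_apply]

/-- An integrable function with square-integrable Fourier transform is square-integrable. -/
theorem memLp_two_of_memLp_fourier {f : E d → ℂ} (hf : Integrable f volume)
    (hF : MemLp (𝓕 f) 2 volume) : MemLp f 2 volume := by
  -- Both sides have the same integral against `φ = 𝓕 (𝓕⁻ φ)`: moving the outer transform across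
  -- yields `𝓕 f` tested against `𝓕⁻ φ` in either case.
  have key : f =ᵐ[volume] (𝓕⁻ (hF.toLp _) : L2 d) := by
    refine ae_eq_of_integral_schwartz hf.locallyIntegrable (locallyIntegrable_L2 _) fun φ => ?_
    have hφ : φ = 𝓕 (𝓕⁻ φ) := (FourierTransform.fourier_fourierInv_eq φ).symm
    rw [hφ, integral_fourier_schwartz_smul hf, ← integral_schwartz_smul_fourier_L2,
      FourierTransform.fourier_fourierInv_eq]
    refine integral_congr_ae ?_
    filter_upwards [hF.coeFn_toLp] with x hx
    rw [hx]
  exact (memLp_congr_ae key).2 (Lp.memLp _)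

theorem fourierInv_apply_eq_fourier_neg (f : E d → ℂ) (x : E d) : 𝓕⁻ f x = 𝓕 f (-x) :=
  Real.fourierInv_eq_fourier_neg f x

theorem memLp_fourierInv {f : E d → ℂ} (hf : Integrable f volume) (hf2 : MemLp f 2 volume) :
    MemLp (𝓕⁻ f) 2 volume := by
  have h : 𝓕⁻ f = 𝓕 f ∘ Neg.neg := funext fun x => fourierInv_apply_eq_fourier_neg f x
  rw [h]
  exact (memLp_fourier hf hf2).comp_measurePreserving (Measure.measurePreserving_neg volume)

theorem eLpNorm_fourierInv {f : E d → ℂ} (hf : Integrable f volume) (hf2 : MemLp f 2 volume) :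
    eLpNorm (𝓕⁻ f) 2 volume = eLpNorm f 2 volume := by
  have h : 𝓕⁻ f = 𝓕 f ∘ Neg.neg := funext fun x => fourierInv_apply_eq_fourier_neg f x
  rw [h, eLpNorm_comp_measurePreserving (memLp_fourier hf hf2).1
    (Measure.measurePreserving_neg volume), eLpNorm_fourier hf hf2]

theorem integral_conj_fourierInv_mul_fourierInv {f g : E d → ℂ} (hf : Integrable f volume)
    (hf2 : MemLp f 2 volume) (hg : Integrable g volume) (hg2 : MemLp g 2 volume) :
    ∫ ξ, 𝓕⁻ g ξ * star (𝓕⁻ f ξ) = ∫ x, g x * star (f x) := by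
  simp_rw [fourierInv_apply_eq_fourier_neg]
  rw [integral_neg_eq_self (fun ξ => 𝓕 g ξ * star (𝓕 f ξ)) volume]
  exact integral_conj_fourier_mul_fourier hf hf2 hg hg2

theorem rdet_ne_zero (h : GL (Fin d) ℝ) : rdet h ≠ 0 :=
  ((Matrix.isUnit_iff_isUnit_det _).1 h.isUnit).ne_zero

theorem det_toEuclideanLin (A : Matrix (Fin d) (Fin d) ℝ) :
    LinearMap.det (Matrix.toEuclideanLin A) = A.det := by
  rw [Matrix.toEuclideanLin_eq_toLin_orthonormal, LinearMap.det_toLin]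

theorem act_mul (A B : Matrix (Fin d) (Fin d) ℝ) (x : E d) : act (A * B) x = act A (act B x) := by
  simp [act, Matrix.toLpLin_mul_same]

theorem act_one (x : E d) : act 1 x = x := by
  simp [act]

theorem inner_act (A : Matrix (Fin d) (Fin d) ℝ) (x y : E d) :
    inner ℝ (act A x) y = inner ℝ x (act Aᵀ y) := by
  simp [act, Matrix.toLpLin_apply, EuclideanSpace.inner_eq_star_dotProduct, Matrix.dotProduct_mulVec,
    Matrix.mulVec_transpose, dotProduct_comm]

theorem continuous_act (A : Matrix (Fin d) (Fin d) ℝ) : Continuous (act A) :=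
  (Matrix.toEuclideanLin A).continuous_of_finiteDimensional

theorem map_act_volume {A : Matrix (Fin d) (Fin d) ℝ} (hA : A.det ≠ 0) :
    Measure.map (act A) (volume : Measure (E d)) = ENNReal.ofReal |A.det⁻¹| • volume := by
  have := Measure.map_linearMap_addHaar_eq_smul_addHaar (volume : Measure (E d))
    (f := Matrix.toEuclideanLin A) (by rwa [det_toEuclideanLin])
  rwa [det_toEuclideanLin] at this

/-- The change of variables `x ↦ A x`. -/
theorem integral_comp_act {A : Matrix (Fin d) (Fin d) ℝ} (hA : A.det ≠ 0) (f : E d → ℂ) :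
    ∫ x, f (act A x) = (|A.det⁻¹| : ℝ) • ∫ x, f x := by
  have hAu : IsUnit A := (Matrix.isUnit_iff_isUnit_det A).2 hA.isUnit
  have hinj : Function.Injective (act A) := by
    obtain ⟨u, rfl⟩ := hAu
    refine Function.LeftInverse.injective (g := act (u⁻¹ : GL (Fin d) ℝ).1) fun x => ?_
    rw [← act_mul]; simp [act_one]
  have hemb : MeasurableEmbedding (act A) :=
    (continuous_act A).measurableEmbedding hinj
  rw [← hemb.integral_map, map_act_volume hA, integral_smul_measure,
    ENNReal.toReal_ofReal (abs_nonneg _)]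

end Wavelet

/-! ### The quasi-regular representation: adjoints and the Fourier picture. -/

namespace Wavelet

variable {d : ℕ}

theorem act_add (A : Matrix (Fin d) (Fin d) ℝ) (x y : E d) : act A (x + y) = act A x + act A y :=
  map_add _ _ _

theorem act_smul (A : Matrix (Fin d) (Fin d) ℝ) (c : ℝ) (x : E d) :
    act A (c • x) = c • act A x :=
  map_smul _ _ _

theorem act_val_inv (h : GL (Fin d) ℝ) (x : E d) :
    act (h : Matrix (Fin d) (Fin d) ℝ) (act ((h⁻¹ : GL (Fin d) ℝ) : Matrix (Fin d) (Fin d) ℝ) x)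
      = x := by
  rw [← act_mul, ← Units.val_mul]; simp [act_one]

theorem dualAct_mul (h k : GL (Fin d) ℝ) (ξ : E d) :
    dualAct (h * k) ξ = dualAct k (dualAct h ξ) := by
  simp [dualAct, Matrix.transpose_mul, act_mul]

theorem dualAct_one (ξ : E d) : dualAct 1 ξ = ξ := by
  simp [dualAct, act_one]

theorem rdet_inv (h : GL (Fin d) ℝ) : rdet h⁻¹ = (rdet h)⁻¹ := by
  have : rdet h * rdet h⁻¹ = 1 := by
    simp only [rdet]
    rw [← Matrix.det_mul, ← Units.val_mul]; simp
  exact eq_inv_of_mul_eq_one_right this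

theorem integral_comp_act_GL (h : GL (Fin d) ℝ) (f : E d → ℂ) :
    ∫ x, f (act (h : Matrix (Fin d) (Fin d) ℝ) x) = (|rdet h|⁻¹ : ℝ) • ∫ x, f x := by
  rw [integral_comp_act (rdet_ne_zero h), abs_inv]; rfl

theorem integrable_comp_act {A : Matrix (Fin d) (Fin d) ℝ} (hA : A.det ≠ 0) {f : E d → ℂ}
    (hf : Integrable f volume) : Integrable (fun x => f (act A x)) volume := by
  refine Integrable.comp_measurable (μ := volume) (f := act A) (g := f) ?_
    (continuous_act A).measurable
  rw [map_act_volume hA]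
  exact hf.smul_measure ENNReal.ofReal_ne_top

theorem memLp_comp_act {A : Matrix (Fin d) (Fin d) ℝ} (hA : A.det ≠ 0) {f : E d → ℂ}
    (hf : MemLp f 2 volume) : MemLp (fun x => f (act A x)) 2 volume := by
  refine MemLp.comp_of_map (f := act A) (g := f) ?_ (continuous_act A).measurable.aemeasurable
  rw [map_act_volume hA]
  exact hf.smul_measure ENNReal.ofReal_ne_top

theorem quasiRegular_coeFn (x : E d) (h : GL (Fin d) ℝ) (f : L2 d) :
    quasiRegular x h f =ᵐ[volume] quasiRegularFun x h f :=
  MemLp.coeFn_toLp _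

theorem ae_comp_act_sub (h : GL (Fin d) ℝ) (x : E d) {p : E d → Prop} (hp : ∀ᵐ y, p y) :
    ∀ᵐ y : E d, p (act (h : Matrix (Fin d) (Fin d) ℝ) (y - x)) := by
  have h1 : ∀ᵐ y : E d, p (act (h : Matrix (Fin d) (Fin d) ℝ) y) := by
    refine ae_of_ae_map (continuous_act _).measurable.aemeasurable ?_
    rw [map_act_volume (rdet_ne_zero h)]
    exact Measure.ae_smul_measure hp _
  exact (measurePreserving_sub_right volume x).quasiMeasurePreserving.ae h1

theorem quasiRegularFun_congr_ae (x : E d) (h : GL (Fin d) ℝ) {f g : E d → ℂ}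
    (hfg : f =ᵐ[volume] g) : quasiRegularFun x h f =ᵐ[volume] quasiRegularFun x h g := by
  filter_upwards [ae_comp_act_sub h⁻¹ x hfg] with y hy
  simp only [quasiRegularFun, hy]

/-- `π(x,h)* = π(-h⁻¹x, h⁻¹)`. -/
theorem inner_quasiRegular (x : E d) (h : GL (Fin d) ℝ) (f g : L2 d) :
    inner ℂ g (quasiRegular x h f) =
      inner ℂ (quasiRegular
        (-(act ((h⁻¹ : GL (Fin d) ℝ) : Matrix (Fin d) (Fin d) ℝ) x)) h⁻¹ g) f := by
  rw [L2.inner_def, L2.inner_def]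
  set c : ℝ := |rdet h| with hc
  have hc0 : 0 < c := abs_pos.2 (rdet_ne_zero h)
  -- The integrand after the substitution `z = h⁻¹(y - x)`. Its Jacobian `|det h|` turns `|det
  -- h|^{-1/2}` into `|det h|^{1/2}`, the normalising factor of `h⁻¹`.
  set F : E d → ℂ := fun z => ((c ^ (-(1 / 2) : ℝ) : ℝ) : ℂ) *
        (f z * star (g (act (h : Matrix (Fin d) (Fin d) ℝ) z + x))) with hF
  have h1 : ∫ y, inner ℂ (g y) (quasiRegular x h f y) =
      ∫ y, F (act ((h⁻¹ : GL (Fin d) ℝ) : Matrix (Fin d) (Fin d) ℝ) (y - x)) := by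
    refine integral_congr_ae ?_
    filter_upwards [quasiRegular_coeFn x h f] with y hy
    simp only [hF, hy, quasiRegularFun, RCLike.inner_apply, act_val_inv, sub_add_cancel, mul_assoc]
    rfl
  rw [h1, integral_sub_right_eq_self (fun w => F
          (act ((h⁻¹ : GL (Fin d) ℝ) : Matrix (Fin d) (Fin d) ℝ) w)) x,
    integral_comp_act_GL h⁻¹, rdet_inv, abs_inv, inv_inv, ← integral_smul]
  refine integral_congr_ae ?_
  filter_upwards [quasiRegular_coeFn
    (-(act ((h⁻¹ : GL (Fin d) ℝ) : Matrix (Fin d) (Fin d) ℝ) x)) h⁻¹ g] with z hz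
  simp only [hF, hz, quasiRegularFun, RCLike.inner_apply, inv_inv, sub_neg_eq_add, act_add,
    act_val_inv, rdet_inv, abs_inv]
  rw [← hc, Real.inv_rpow hc0.le, Real.rpow_neg hc0.le, inv_inv, ← Real.sqrt_eq_rpow]
  simp only [map_mul, Complex.conj_ofReal, Complex.real_smul]
  have : ((c : ℝ) : ℂ) * (((Real.sqrt c)⁻¹ : ℝ) : ℂ) = ((Real.sqrt c : ℝ) : ℂ) := by
    rw [← Complex.ofReal_mul]; congr 1
    field_simp
    exact (Real.sq_sqrt hc0.le).symm
  rw [← mul_assoc, this]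
  simp only [RCLike.star_def]
  ring

/-- The action of `π(x,h)` after the inverse Fourier transform. -/
theorem quasiRegularFun_fourierInv (x : E d) (h : GL (Fin d) ℝ) (G : E d → ℂ) (y : E d) :
    quasiRegularFun x h (𝓕⁻ G) y = 𝓕⁻ (fun ξ => ((|rdet h| ^ (1 / 2 : ℝ) : ℝ) : ℂ) *
      ((Real.fourierChar (-(inner ℝ x ξ)) : ℂ) * G (dualAct h ξ))) y := by
  set c : ℝ := |rdet h| with hc
  have hc0 : 0 < c := abs_pos.2 (rdet_ne_zero h)
  simp only [quasiRegularFun, Real.fourierInv_eq]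
  set F : E d → ℂ := fun η => ((c ^ (1 / 2 : ℝ) : ℝ) : ℂ) * (Real.fourierChar (inner ℝ η
    (act ((h⁻¹ : GL (Fin d) ℝ) : Matrix (Fin d) (Fin d) ℝ) (y - x))) • G η) with hF
  have h1 : ∀ ξ : E d, Real.fourierChar (inner ℝ ξ y) • (((c ^ (1 / 2 : ℝ) : ℝ) : ℂ) *
      ((Real.fourierChar (-(inner ℝ x ξ)) : ℂ) * G (dualAct h ξ))) =
      F (act ((h : Matrix (Fin d) (Fin d) ℝ)ᵀ) ξ) := by
    intro ξ
    simp only [hF, dualAct]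
    rw [inner_act, Matrix.transpose_transpose, act_val_inv, inner_sub_right, sub_eq_add_neg,
      AddChar.map_add_eq_mul, real_inner_comm ξ x]
    simp only [Circle.smul_def, Circle.coe_mul, smul_eq_mul]
    ring
  rw [integral_congr_ae (ae_of_all _ h1), integral_comp_act (A := (h : Matrix (Fin d) (Fin d) ℝ)ᵀ)
    (by rw [Matrix.det_transpose]; exact rdet_ne_zero h), hF, integral_const_mul,
    Matrix.det_transpose, Complex.real_smul, ← mul_assoc, ← Complex.ofReal_mul]
  congr 2
  rw [abs_inv, show |(h : Matrix (Fin d) (Fin d) ℝ).det| = c from rfl, Real.rpow_neg hc0.le,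
    ← Real.sqrt_eq_rpow]
  field_simp
  exact (Real.sq_sqrt hc0.le).symm

end Wavelet

/-! ### Consequences of irreducibility: null complement, uniqueness of the open orbit, cone
property. -/

namespace Wavelet

variable {d : ℕ}

theorem continuous_dualAct (h : GL (Fin d) ℝ) : Continuous (dualAct h) := continuous_act _

/-- A set is invariant under the dual action. -/
def IsDualInvariant (H : Subgroup (GL (Fin d) ℝ)) (O : Set (E d)) : Prop :=
  ∀ h ∈ H, ∀ ξ ∈ O, dualAct h ξ ∈ O

theorem IsOpenDualOrbit.isDualInvariant {H : Subgroup (GL (Fin d) ℝ)} {O : Set (E d)}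
    (hO : IsOpenDualOrbit H O) : IsDualInvariant H O := by
  obtain ⟨-, ξ₀, rfl⟩ := hO
  rintro h hh _ ⟨k, rfl⟩
  exact ⟨k * ⟨h, hh⟩, by simp [dualAct_mul]⟩

theorem IsOpenDualOrbit.nonempty {H : Subgroup (GL (Fin d) ℝ)} {O : Set (E d)}
    (hO : IsOpenDualOrbit H O) : O.Nonempty := by
  obtain ⟨-, ξ₀, rfl⟩ := hO
  exact ⟨_, ⟨1, rfl⟩⟩

/-- `g` is the inverse Fourier transform of a function in `L¹ ∩ L²` vanishing on `O`. -/
def IsSpectralOff (O : Set (E d)) (g : L2 d) : Prop :=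
  ∃ G : E d → ℂ, Integrable G volume ∧ MemLp G 2 volume ∧ (∀ ξ ∈ O, G ξ = 0) ∧
    g =ᵐ[volume] 𝓕⁻ G

/-- On the Fourier side `π(x,h)` is a modulation composed with `ξ ↦ h^T ξ`, which maps `O` into
itself. -/
theorem IsSpectralOff.quasiRegular {H : Subgroup (GL (Fin d) ℝ)} {O : Set (E d)}
    (hO : IsDualInvariant H O) {g : L2 d} (hg : IsSpectralOff O g) (x : E d)
    {h : GL (Fin d) ℝ} (hh : h ∈ H) : IsSpectralOff O (quasiRegular x h g) := by
  obtain ⟨G, hG1, hG2, hG0, hgG⟩ := hg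
  have hdet : ((h : Matrix (Fin d) (Fin d) ℝ)ᵀ).det ≠ 0 := by
    rw [Matrix.det_transpose]; exact rdet_ne_zero h
  have hcont : Continuous fun ξ : E d => (Real.fourierChar (-(inner ℝ x ξ)) : ℂ) :=
    continuous_subtype_val.comp (Real.continuous_fourierChar.comp
      ((continuous_const.inner continuous_id).neg))
  have hb : ∀ᵐ ξ : E d, ‖(Real.fourierChar (-(inner ℝ x ξ)) : ℂ)‖ ≤ 1 :=
    ae_of_all _ fun ξ => (Circle.norm_coe _).le
  refine ⟨fun ξ => ((|rdet h| ^ (1 / 2 : ℝ) : ℝ) : ℂ) *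
      ((Real.fourierChar (-(inner ℝ x ξ)) : ℂ) * G (dualAct h ξ)), ?_, ?_, ?_, ?_⟩
  · exact ((integrable_comp_act hdet hG1).bdd_mul hcont.aestronglyMeasurable hb).const_mul _
  · refine ((memLp_comp_act hdet hG2).of_le (hcont.aestronglyMeasurable.mul
      (memLp_comp_act hdet hG2).1) (ae_of_all _ fun ξ => ?_)).const_mul _
    rw [Pi.mul_apply, norm_mul, Circle.norm_coe, one_mul]
  · intro ξ hξ
    simp [hG0 _ (hO h hh ξ hξ)]
  · refine (quasiRegular_coeFn x h g).trans ((quasiRegularFun_congr_ae x h hgG).trans ?_)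
    exact ae_of_all _ fun y => quasiRegularFun_fourierInv x h G y

theorem integrable_indicator_one {B : Set (E d)} (hB : MeasurableSet B)
    (hfin : volume B < ⊤) : Integrable (B.indicator (fun _ => (1 : ℂ))) volume :=
  (integrable_indicator_iff hB).2 (integrableOn_const hfin.ne)

theorem memLp_indicator_one {B : Set (E d)} (hB : MeasurableSet B)
    (hfin : volume B < ⊤) : MemLp (B.indicator (fun _ => (1 : ℂ))) 2 volume :=
  memLp_indicator_const 2 hB 1 (Or.inr hfin.ne)

/-- The inverse Fourier transform of the indicator function of a set of finite measure, as an
element of `L²`. -/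
theorem exists_L2_fourierInv_indicator {B : Set (E d)} (hB : MeasurableSet B)
    (hfin : volume B < ⊤) : ∃ g : L2 d, g =ᵐ[volume] 𝓕⁻ (B.indicator (fun _ => (1 : ℂ))) ∧
      (g = 0 → volume B = 0) := by
  have h1 := integrable_indicator_one hB hfin
  have h2 := memLp_indicator_one hB hfin
  refine ⟨(memLp_fourierInv h1 h2).toLp _, MemLp.coeFn_toLp _, fun h0 => ?_⟩
  have h3 : eLpNorm (B.indicator (fun _ => (1 : ℂ))) 2 volume = 0 := by
    rw [← eLpNorm_fourierInv h1 h2, ← eLpNorm_congr_ae (memLp_fourierInv h1 h2).coeFn_toLp, h0]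
    rw [eLpNorm_congr_ae (Lp.coeFn_zero _ _ _)]
    exact eLpNorm_zero
  rw [eLpNorm_eq_zero_iff h2.1 (by norm_num)] at h3
  have h4 : B ⊆ {ξ | ¬ B.indicator (fun _ => (1 : ℂ)) ξ = (0 : E d → ℂ) ξ} := fun ξ hξ => by
    simp [hξ]
  exact measure_mono_null h4 (ae_iff.1 h3)

/-- If `π` is irreducible then the complement of an open invariant set is a null set. -/
theorem IsIrreducibleRep.volume_compl_eq_zero {H : Subgroup (GL (Fin d) ℝ)}
    (hH : IsIrreducibleRep H) {O : Set (E d)} (hO : IsOpen O) (hne : O.Nonempty)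
    (hinv : IsDualInvariant H O) : volume Oᶜ = 0 := by
  -- Taking the orthogonal complement makes closedness automatic; invariance follows since the
  -- adjoint of `π(x,h)` is again an operator of the representation.
  set K : Submodule ℂ (L2 d) := (Submodule.span ℂ {g | IsSpectralOff O g})ᗮ with hK
  have hmem : ∀ f : L2 d, f ∈ K ↔ ∀ g, IsSpectralOff O g → inner ℂ g f = 0 := by
    intro f
    rw [hK, Submodule.mem_orthogonal]
    refine ⟨fun hf g hg => hf g (Submodule.subset_span hg), fun hf u hu => ?_⟩
    induction hu using Submodule.span_induction with
    | mem g hg => exact hf g hg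
    | zero => simp
    | add a b _ _ ha hb => rw [inner_add_left, ha, hb, add_zero]
    | smul c a _ ha => rw [inner_smul_left, ha, mul_zero]
  have hK' : K = ⊥ ∨ K = ⊤ := by
    refine hH K (Submodule.isClosed_orthogonal _) fun x h f hf => ?_
    rw [hmem] at hf ⊢
    intro g hg
    rw [inner_quasiRegular]
    exact hf _ (hg.quasiRegular hinv _ (H.inv_mem h.2))
  have hbot : K ≠ ⊥ := by
    intro hbot
    obtain ⟨ξ, hξ⟩ := hne
    obtain ⟨r, hr, hball⟩ := Metric.isOpen_iff.1 hO ξ hξ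
    obtain ⟨g, hg, hg0⟩ := exists_L2_fourierInv_indicator (B := Metric.ball ξ r)
      measurableSet_ball measure_ball_lt_top
    refine (Metric.measure_ball_pos volume ξ hr).ne' (hg0 ?_)
    have : g ∈ K := by
      rw [hmem]
      rintro f ⟨F, hF1, hF2, hF0, hfF⟩
      rw [L2.inner_def]
      have h1 := integral_conj_fourierInv_mul_fourierInv hF1 hF2
        (integrable_indicator_one (B := Metric.ball ξ r) measurableSet_ball measure_ball_lt_top)
        (memLp_indicator_one measurableSet_ball measure_ball_lt_top)
      have h2 : ∀ x, (Metric.ball ξ r).indicator (fun _ => (1 : ℂ)) x * star (F x) = 0 := by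
        intro x
        by_cases hx : x ∈ Metric.ball ξ r
        · simp [hF0 x (hball hx)]
        · simp [hx]
      simp only [h2, integral_zero] at h1
      rw [← h1]
      refine integral_congr_ae ?_
      filter_upwards [hg, hfF] with x hx1 hx2
      simp [hx1, hx2, RCLike.inner_apply]
    rwa [hbot, Submodule.mem_bot] at this
  have htop : K = ⊤ := hK'.resolve_left hbot
  have hzero : ∀ g, IsSpectralOff O g → g = 0 := by
    intro g hg
    have : g ∈ K := htop ▸ Submodule.mem_top
    exact inner_self_eq_zero.1 ((hmem g).1 this g hg)
  -- Truncation to balls makes the indicator of `Oᶜ` integrable.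
  have hball : ∀ n : ℕ, volume (Oᶜ ∩ Metric.ball 0 n) = 0 := by
    intro n
    have hB : MeasurableSet (Oᶜ ∩ Metric.ball (0 : E d) n) :=
      hO.measurableSet.compl.inter measurableSet_ball
    have hfin : volume (Oᶜ ∩ Metric.ball (0 : E d) n) < ⊤ :=
      (measure_mono Set.inter_subset_right).trans_lt measure_ball_lt_top
    obtain ⟨g, hg, hg0⟩ := exists_L2_fourierInv_indicator hB hfin
    refine hg0 (hzero g ⟨_, integrable_indicator_one hB hfin, memLp_indicator_one hB hfin,
      fun ξ hξ => ?_, hg⟩)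
    simp [hξ]
  have hU : Oᶜ = ⋃ n : ℕ, Oᶜ ∩ Metric.ball 0 n := by
    rw [← Set.inter_iUnion, Metric.iUnion_ball_nat, Set.inter_univ]
  rw [hU]
  exact measure_iUnion_null hball

/-- For irreducible `π` there is at most one open dual orbit. -/
theorem IsOpenDualOrbit.subset {H : Subgroup (GL (Fin d) ℝ)} (hH : IsIrreducibleRep H)
    {O U : Set (E d)} (hO : IsOpenDualOrbit H O) (hU : IsDualInvariant H U) (hUo : IsOpen U)
    (hUne : U.Nonempty) : O ⊆ U := by
  have h0 := hH.volume_compl_eq_zero hUo hUne hU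
  have hne : (O ∩ U).Nonempty := by
    by_contra hcon
    rw [Set.not_nonempty_iff_eq_empty, ← Set.disjoint_iff_inter_eq_empty] at hcon
    exact (hO.1.measure_pos volume hO.nonempty).ne'
      (measure_mono_null hcon.subset_compl_right h0)
  obtain ⟨-, ξ₀, rfl⟩ := hO
  obtain ⟨_, ⟨k, rfl⟩, hk⟩ := hne
  rintro _ ⟨h, rfl⟩
  have := hU ((k : GL (Fin d) ℝ)⁻¹ * h) (H.mul_mem (H.inv_mem k.2) h.2) _ hk
  rwa [← dualAct_mul, mul_inv_cancel_left] at this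

/-- Scalars commute with the dual action, so the preimage of `O` under multiplication by `c` is
again open and invariant, and it must contain `O`. -/
theorem IsOpenDualOrbit.smul_mem {H : Subgroup (GL (Fin d) ℝ)} (hH : IsIrreducibleRep H)
    {O : Set (E d)} (hO : IsOpenDualOrbit H O) {c : ℝ} (hc : c ≠ 0) {ξ : E d} (hξ : ξ ∈ O) :
    c • ξ ∈ O := by
  have hsub : O ⊆ (fun η : E d => c • η) ⁻¹' O := by
    refine hO.subset hH (fun h hh η hη => ?_) (hO.1.preimage (continuous_const_smul c)) ?_
    · have : c • dualAct h η = dualAct h (c • η) := (act_smul _ c η).symm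
      simp only [Set.mem_preimage, this]
      exact hO.isDualInvariant h hh _ hη
    · obtain ⟨η, hη⟩ := hO.nonempty
      exact ⟨c⁻¹ • η, by simpa [smul_smul, hc] using hη⟩
  exact hsub hξ

/-- The orbit of the origin is a single point, which is not open in positive dimension. -/
theorem IsOpenDualOrbit.zero_notMem (hd : 0 < d) {H : Subgroup (GL (Fin d) ℝ)}
    {O : Set (E d)} (hO : IsOpenDualOrbit H O) : (0 : E d) ∉ O := by
  intro h0
  have : Nonempty (Fin d) := ⟨⟨0, hd⟩⟩
  have hall : ∀ ξ ∈ O, ξ = 0 := by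
    obtain ⟨-, ξ₀, rfl⟩ := hO
    obtain ⟨k, hk⟩ := h0
    rintro _ ⟨h, rfl⟩
    have h1 : ξ₀ = dualAct ((k : GL (Fin d) ℝ)⁻¹) 0 := by
      rw [← hk]
      simp only
      rw [← dualAct_mul, mul_inv_cancel, dualAct_one]
    rw [h1]; simp [dualAct, act]
  have : O = {0} := Set.Subset.antisymm (fun ξ hξ => hall ξ hξ) (by simpa using h0)
  exact not_isOpen_singleton (0 : E d) (this ▸ hO.1)

/-- The complement of the open dual orbit is a cone. -/
theorem IsOpenDualOrbit.smul_mem_compl (hd : 0 < d) {H : Subgroup (GL (Fin d) ℝ)}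
    (hH : IsIrreducibleRep H) {O : Set (E d)} (hO : IsOpenDualOrbit H O) (c : ℝ) {ξ : E d}
    (hξ : ξ ∈ Oᶜ) : c • ξ ∈ Oᶜ := by
  rcases eq_or_ne c 0 with rfl | hc
  · simpa using hO.zero_notMem hd
  · intro h
    refine hξ ?_
    simpa [smul_smul, hc] using hO.smul_mem hH (inv_ne_zero hc) h

end Wavelet

/-! ### The admissibility criterion. -/

namespace Wavelet

variable {d : ℕ}

theorem secondCountable_GL : SecondCountableTopology (GL (Fin d) ℝ) := by
  have h1 : SecondCountableTopology (Matrix (Fin d) (Fin d) ℝ) :=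
    inferInstanceAs (SecondCountableTopology (Fin d → Fin d → ℝ))
  have h2 : SecondCountableTopology (Matrix (Fin d) (Fin d) ℝ)ᵐᵒᵖ :=
    MulOpposite.opHomeomorph.symm.isEmbedding.secondCountableTopology
  exact Units.isEmbedding_embedProduct.secondCountableTopology

theorem secondCountable_subgroup (H : Subgroup (GL (Fin d) ℝ)) : SecondCountableTopology H := by
  have h1 : SecondCountableTopology (GL (Fin d) ℝ) := secondCountable_GL
  exact TopologicalSpace.Subtype.secondCountableTopology (H : Set (GL (Fin d) ℝ))

theorem locallyCompact_GL : LocallyCompactSpace (GL (Fin d) ℝ) := by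
  have h1 : LocallyCompactSpace (Matrix (Fin d) (Fin d) ℝ) :=
    inferInstanceAs (LocallyCompactSpace (Fin d → Fin d → ℝ))
  have h3 : T1Space (Matrix (Fin d) (Fin d) ℝ) :=
    inferInstanceAs (T1Space (Fin d → Fin d → ℝ))
  have h2 : LocallyCompactSpace (Matrix (Fin d) (Fin d) ℝ)ᵐᵒᵖ :=
    MulOpposite.opHomeomorph.symm.isClosedEmbedding.locallyCompactSpace
  exact Units.isClosedEmbedding_embedProduct.locallyCompactSpace

theorem sigmaFinite_haar {H : Subgroup (GL (Fin d) ℝ)} (hH : IsClosed (H : Set (GL (Fin d) ℝ)))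
    [MeasurableSpace H] [BorelSpace H] (μ : Measure H) [μ.IsHaarMeasure] : SigmaFinite μ := by
  have h1 : SecondCountableTopology (GL (Fin d) ℝ) := secondCountable_GL
  have h2 : LocallyCompactSpace (GL (Fin d) ℝ) := locallyCompact_GL
  have h3 : LocallyCompactSpace H := hH.locallyCompactSpace
  have h5 : SecondCountableTopology H := secondCountable_subgroup H
  have h4 : SigmaCompactSpace H := sigmaCompactSpace_of_locallyCompact_secondCountable
  exact Measure.IsHaarMeasure.sigmaFinite μ

theorem continuous_act_comp {X : Type*} [TopologicalSpace X]
    {f : X → Matrix (Fin d) (Fin d) ℝ}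
    {g : X → E d} (hf : Continuous f) (hg : Continuous g) :
    Continuous fun x => act (f x) (g x) := by
  simp only [act, Matrix.toLpLin_apply]
  exact (PiLp.continuous_toLp 2 _).comp
    (Continuous.matrix_mulVec hf ((PiLp.continuous_ofLp 2 _).comp hg))

theorem continuous_dualAct_comp {X : Type*} [TopologicalSpace X] {f : X → GL (Fin d) ℝ}
    {g : X → E d} (hf : Continuous f) (hg : Continuous g) :
    Continuous fun x => dualAct (f x) (g x) := by
  have h1 : Continuous fun x => ((f x : Matrix (Fin d) (Fin d) ℝ)ᵀ) :=
    Continuous.matrix_transpose (Units.continuous_val.comp hf)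
  exact continuous_act_comp h1 hg

theorem continuous_rdet : Continuous (rdet : GL (Fin d) ℝ → ℝ) :=
  Units.continuous_val.matrix_det

theorem quasiRegularFun_integrable (x : E d) (h : GL (Fin d) ℝ) {ψ : E d → ℂ}
    (hψ : Integrable ψ volume) : Integrable (quasiRegularFun x h ψ) volume := by
  have h1 := integrable_comp_act (rdet_ne_zero h⁻¹) hψ
  exact ((measurePreserving_sub_right volume x).integrable_comp_of_integrable h1).const_mul _

/-- The action of `π(x,h)` on the Fourier side. -/
theorem fourier_quasiRegularFun (x : E d) (h : GL (Fin d) ℝ) (ψ : E d → ℂ) (ξ : E d) :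
    𝓕 (quasiRegularFun x h ψ) ξ = ((|rdet h| ^ (1 / 2 : ℝ) : ℝ) : ℂ) *
      ((Real.fourierChar (-(inner ℝ x ξ)) : ℂ) * 𝓕 ψ (dualAct h ξ)) := by
  set c : ℝ := |rdet h| with hc
  have hc0 : 0 < c := abs_pos.2 (rdet_ne_zero h)
  simp only [quasiRegularFun, Real.fourier_eq]
  set F : E d → ℂ := fun z => (((c ^ (-(1 / 2) : ℝ) : ℝ) : ℂ) *
    (Real.fourierChar (-(inner ℝ x ξ)) : ℂ)) *
      (Real.fourierChar (-(inner ℝ z (dualAct h ξ))) • ψ z) with hF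
  have h1 : ∀ y : E d, Real.fourierChar (-(inner ℝ y ξ)) • (((c ^ (-(1 / 2) : ℝ) : ℝ) : ℂ) *
      ψ (act ((h⁻¹ : GL (Fin d) ℝ) : Matrix (Fin d) (Fin d) ℝ) (y - x))) =
      F (act ((h⁻¹ : GL (Fin d) ℝ) : Matrix (Fin d) (Fin d) ℝ) (y - x)) := by
    intro y
    simp only [hF, dualAct]
    rw [← inner_act, act_val_inv, inner_sub_left]
    have : (-(inner ℝ y ξ) : ℝ) = -(inner ℝ x ξ) + -(inner ℝ y ξ - inner ℝ x ξ) := by ring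
    rw [this, AddChar.map_add_eq_mul]
    simp only [Circle.smul_def, Circle.coe_mul, smul_eq_mul]
    ring
  rw [integral_congr_ae (ae_of_all _ h1), integral_sub_right_eq_self (fun w => F
    (act ((h⁻¹ : GL (Fin d) ℝ) : Matrix (Fin d) (Fin d) ℝ) w)) x, integral_comp_act_GL h⁻¹ F,
    rdet_inv, abs_inv, inv_inv, hF, integral_const_mul, Complex.real_smul, ← mul_assoc, ← mul_assoc,
    ← mul_assoc, ← Complex.ofReal_mul]
  congr 3
  rw [← hc, Real.rpow_neg hc0.le, ← Real.sqrt_eq_rpow]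
  field_simp
  exact (Real.sq_sqrt hc0.le).symm

/-- The Fourier transform of `⟨ψ, π(·,h)ψ⟩`. -/
noncomputable def waveletSpectrum (ψ : E d → ℂ) (h : GL (Fin d) ℝ) (ξ : E d) : ℂ :=
  ((|rdet h| ^ (1 / 2 : ℝ) : ℝ) : ℂ) * (𝓕 ψ ξ * star (𝓕 ψ (dualAct h ξ)))

theorem waveletTransform_eq_fourierInv {H : Subgroup (GL (Fin d) ℝ)} {ψ : E d → ℂ}
    (hψ : Integrable ψ volume) (hψ2 : MemLp ψ 2 volume) (p : E d × H) :
    waveletTransform H (hψ2.toLp ψ) (hψ2.toLp ψ) p =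
      𝓕⁻ (waveletSpectrum ψ (p.2 : GL (Fin d) ℝ)) p.1 := by
  obtain ⟨x, h⟩ := p
  have h1 : waveletTransform H (hψ2.toLp ψ) (hψ2.toLp ψ) (x, h) =
      ∫ y, ψ y * star (quasiRegularFun x (h : GL (Fin d) ℝ) ψ y) := by
    rw [waveletTransform, L2.inner_def]
    refine integral_congr_ae ?_
    filter_upwards [hψ2.coeFn_toLp, quasiRegular_coeFn x (h : GL (Fin d) ℝ) (hψ2.toLp ψ),
      quasiRegularFun_congr_ae x (h : GL (Fin d) ℝ) hψ2.coeFn_toLp] with y h1 h2 h3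
    simp only [h1, h2, h3, RCLike.inner_apply]
    rfl
  rw [h1, ← integral_conj_fourier_mul_fourier (quasiRegularFun_integrable x _ hψ)
    (memLp_quasiRegularFun x _ hψ2) hψ hψ2, Real.fourierInv_eq]
  refine integral_congr_ae (ae_of_all _ fun ξ => ?_)
  simp only [fourier_quasiRegularFun, waveletSpectrum]
  rw [AddChar.map_neg_eq_inv, Circle.coe_inv_eq_conj, real_inner_comm x ξ]
  simp only [star_mul', Circle.smul_def, smul_eq_mul, RCLike.star_def, Complex.conj_conj,
    Complex.conj_ofReal]
  ring

/-- Inverting the Fourier transform writes the wavelet transform as an integral whose integrand is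
jointly continuous in `(x, h, ξ)`. -/
theorem measurable_waveletTransform {H : Subgroup (GL (Fin d) ℝ)} [MeasurableSpace H]
    [BorelSpace H] {ψ : E d → ℂ} (hψ : Integrable ψ volume) (hψ2 : MemLp ψ 2 volume) :
    StronglyMeasurable (waveletTransform H (hψ2.toLp ψ) (hψ2.toLp ψ)) := by
  have hG : SecondCountableTopology H := secondCountable_subgroup H
  have h1 : waveletTransform H (hψ2.toLp ψ) (hψ2.toLp ψ) =
      fun p : E d × H => ∫ ξ, Real.fourierChar (inner ℝ ξ p.1) •
        waveletSpectrum ψ (p.2 : GL (Fin d) ℝ) ξ := by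
    funext p
    rw [waveletTransform_eq_fourierInv hψ, Real.fourierInv_eq]
  rw [h1]
  have hc := continuous_fourier hψ
  have h2 : Continuous fun q : (E d × H) × E d => Real.fourierChar (inner ℝ q.2 q.1.1) •
      waveletSpectrum ψ (q.1.2 : GL (Fin d) ℝ) q.2 := by
    have hh : Continuous fun q : (E d × H) × E d => (q.1.2 : GL (Fin d) ℝ) :=
      continuous_subtype_val.comp (continuous_snd.comp continuous_fst)
    simp only [Circle.smul_def]
    refine Continuous.smul (continuous_subtype_val.comp (Real.continuous_fourierChar.comp
      (continuous_snd.inner (continuous_fst.comp continuous_fst)))) ?_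
    refine Continuous.mul ?_ (Continuous.mul (hc.comp continuous_snd) ?_)
    · exact Complex.continuous_ofReal.comp
        ((continuous_rdet.comp hh).abs.rpow_const fun q => Or.inr (by norm_num))
    · exact (hc.comp (continuous_dualAct_comp hh continuous_snd)).star
  exact h2.stronglyMeasurable.integral_prod_right

/-- The dual action is a right action, so moving the base point within the orbit is a left
translation of the variable in `H`, which Haar measure does not see. -/
theorem IsOpenDualOrbit.lintegral_eq {H : Subgroup (GL (Fin d) ℝ)} [MeasurableSpace H]
    [BorelSpace H] (μ : Measure H) [μ.IsHaarMeasure] {O : Set (E d)} (hO : IsOpenDualOrbit H O)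
    {ξ₀ ξ : E d} (hξ₀ : ξ₀ ∈ O) (hξ : ξ ∈ O) (f : E d → ℝ≥0∞) :
    ∫⁻ h : H, f (dualAct (h : GL (Fin d) ℝ) ξ) ∂μ =
      ∫⁻ h : H, f (dualAct (h : GL (Fin d) ℝ) ξ₀) ∂μ := by
  obtain ⟨-, η, rfl⟩ := hO
  obtain ⟨a, rfl⟩ := hξ
  obtain ⟨b, rfl⟩ := hξ₀
  simp only [← dualAct_mul, ← Subgroup.coe_mul]
  rw [lintegral_mul_left_eq_self (μ := μ) (fun h : H => f (dualAct (h : GL (Fin d) ℝ) η)) a,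
    lintegral_mul_left_eq_self (μ := μ) (fun h : H => f (dualAct (h : GL (Fin d) ℝ) η)) b]

theorem enorm_sq_waveletSpectrum (ψ : E d → ℂ) (h : GL (Fin d) ℝ) (ξ : E d) :
    ‖waveletSpectrum ψ h ξ‖ₑ ^ 2 =
      ENNReal.ofReal |rdet h| * (‖𝓕 ψ ξ‖ₑ ^ 2 * ‖𝓕 ψ (dualAct h ξ)‖ₑ ^ 2) := by
  have h1 : ‖((|rdet h| ^ (1 / 2 : ℝ) : ℝ) : ℂ)‖ₑ ^ 2 = ENNReal.ofReal |rdet h| := by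
    rw [← ofReal_norm, ← ENNReal.ofReal_pow (norm_nonneg _), Complex.norm_real,
      Real.norm_of_nonneg (by positivity), ← Real.sqrt_eq_rpow, Real.sq_sqrt (abs_nonneg _)]
  rw [waveletSpectrum, enorm_mul, enorm_mul, mul_pow, mul_pow, h1]
  congr 3
  simp [enorm_eq_nnnorm]

theorem eLpNorm_two_sq {α : Type*} [MeasurableSpace α] (μ : Measure α) (f : α → ℂ) :
    eLpNorm f 2 μ ^ 2 = ∫⁻ x, ‖f x‖ₑ ^ 2 ∂μ := by
  rw [eLpNorm_eq_lintegral_rpow_enorm_toReal (by norm_num) (by norm_num), ← ENNReal.rpow_natCast,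
    ← ENNReal.rpow_mul]
  simp

theorem measurable_enorm_mul_dualAct {H : Subgroup (GL (Fin d) ℝ)} [MeasurableSpace H]
    [BorelSpace H] {F : E d → ℂ} (hF : Continuous F) : Measurable fun p : H × E d =>
      ‖F p.2‖ₑ ^ 2 * ‖F (dualAct (p.1 : GL (Fin d) ℝ) p.2)‖ₑ ^ 2 := by
  have hH : SecondCountableTopology H := secondCountable_subgroup H
  have hh : Continuous fun p : H × E d => (p.1 : GL (Fin d) ℝ) :=
    continuous_subtype_val.comp continuous_fst
  have hd : Continuous fun p : H × E d => dualAct (p.1 : GL (Fin d) ℝ) p.2 :=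
    continuous_dualAct_comp hh continuous_snd
  have h1 : Measurable fun p : H × E d => F p.2 := (hF.comp continuous_snd).measurable
  have h2 : Measurable fun p : H × E d => F (dualAct (p.1 : GL (Fin d) ℝ) p.2) :=
    (hF.comp hd).measurable
  exact (h1.enorm.pow_const 2).mul (h2.enorm.pow_const 2)

/-- Admissibility criterion: if `∫_H |ψ^(h^T ξ₀)|² dh < ∞` then `ψ` is admissible. -/
theorem isAdmissibleFun_of_lintegral_lt_top {H : Subgroup (GL (Fin d) ℝ)} [MeasurableSpace H]
    [BorelSpace H] {μ : Measure H} [μ.IsHaarMeasure] (hH : IsAdmissibleDilationGroup H μ)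
    {O : Set (E d)} (hO : IsOpenDualOrbit H O) {ξ₀ : E d} (hξ₀ : ξ₀ ∈ O) {ψ : E d → ℂ}
    (hψ : Integrable ψ volume) (hψ2 : MemLp ψ 2 volume) (hne : ¬ ψ =ᵐ[volume] 0)
    (hfin : ∫⁻ h : H, ‖𝓕 ψ (dualAct (h : GL (Fin d) ℝ) ξ₀)‖ₑ ^ 2 ∂μ < ⊤) :
    IsAdmissibleFun H μ ψ := by
  have hG : SecondCountableTopology H := secondCountable_subgroup H
  have hσ : SigmaFinite μ := sigmaFinite_haar hH.closed μ
  have hc := continuous_fourier hψ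
  have hF2 := memLp_fourier hψ hψ2
  refine ⟨hψ2, fun h0 => hne ?_, ?_⟩
  · exact (hψ2.coeFn_toLp.symm.trans (by rw [h0]; exact Lp.coeFn_zero _ _ _))
  have hmeas := measurable_waveletTransform (H := H) hψ hψ2
  refine ⟨hmeas.aestronglyMeasurable, ?_⟩
  have hspec : ∀ h : H, ∫⁻ x, ‖waveletTransform H (hψ2.toLp ψ) (hψ2.toLp ψ) (x, h)‖ₑ ^ 2 =
      ENNReal.ofReal |rdet (h : GL (Fin d) ℝ)| *
        ∫⁻ ξ, (‖𝓕 ψ ξ‖ₑ ^ 2 * ‖𝓕 ψ (dualAct (h : GL (Fin d) ℝ) ξ)‖ₑ ^ 2) := by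
    intro h
    have hdual : MemLp (fun ξ => star (𝓕 ψ (dualAct (h : GL (Fin d) ℝ) ξ))) 2 volume :=
      (memLp_comp_act (by rw [Matrix.det_transpose]; exact rdet_ne_zero _) hF2).star
    have hs1 : Integrable (waveletSpectrum ψ (h : GL (Fin d) ℝ)) volume :=
      (hF2.integrable_mul hdual).const_mul _
    have hs2 : MemLp (waveletSpectrum ψ (h : GL (Fin d) ℝ)) 2 volume := by
      refine (MemLp.of_le_mul (c := ∫ x, ‖ψ x‖) hdual (hF2.1.mul hdual.1)
        (ae_of_all _ fun ξ => ?_)).const_mul _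
      -- `ψ^` is bounded by `‖ψ‖₁`, so the product stays in `L²`.
      rw [Pi.mul_apply, norm_mul]
      exact mul_le_mul_of_nonneg_right (VectorFourier.norm_fourierIntegral_le_integral_norm _ _ _ _ _)
        (norm_nonneg _)
    have h1 : ∀ x, waveletTransform H (hψ2.toLp ψ) (hψ2.toLp ψ) (x, h) =
        𝓕⁻ (waveletSpectrum ψ (h : GL (Fin d) ℝ)) x :=
      fun x => waveletTransform_eq_fourierInv hψ hψ2 (x, h)
    simp_rw [h1]
    rw [← eLpNorm_two_sq, eLpNorm_fourierInv hs1 hs2, eLpNorm_two_sq]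
    simp_rw [enorm_sq_waveletSpectrum]
    refine lintegral_const_mul' _ _ ENNReal.ofReal_ne_top
  have hdet : Measurable fun p : E d × H => ENNReal.ofReal (|rdet (p.2 : GL (Fin d) ℝ)|⁻¹) :=
    (((continuous_rdet.comp (continuous_subtype_val.comp
      continuous_snd)).measurable.abs).inv).ennreal_ofReal
  have hkey : eLpNorm (waveletTransform H (hψ2.toLp ψ) (hψ2.toLp ψ)) 2 (haarG H μ) ^ 2 < ⊤ := by
    rw [eLpNorm_two_sq, haarG,
      lintegral_withDensity_eq_lintegral_mul _ hdet (hmeas.enorm.pow_const 2),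
      lintegral_prod_symm' _ (hdet.mul (hmeas.enorm.pow_const 2))]
    have h2 : ∀ h : H, ∫⁻ x : E d, ((fun p : E d × H =>
        ENNReal.ofReal (|rdet (p.2 : GL (Fin d) ℝ)|⁻¹)) *
          fun p => ‖waveletTransform H (hψ2.toLp ψ) (hψ2.toLp ψ) p‖ₑ ^ 2) (x, h) =
        ∫⁻ ξ, (‖𝓕 ψ ξ‖ₑ ^ 2 * ‖𝓕 ψ (dualAct (h : GL (Fin d) ℝ) ξ)‖ₑ ^ 2) := by
      intro h
      have hpos : 0 < |rdet (h : GL (Fin d) ℝ)| := abs_pos.2 (rdet_ne_zero _)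
      simp only [Pi.mul_apply]
      rw [lintegral_const_mul' _ _ ENNReal.ofReal_ne_top, hspec, ← mul_assoc,
        ← ENNReal.ofReal_mul (by positivity), inv_mul_cancel₀ hpos.ne', ENNReal.ofReal_one, one_mul]
    simp_rw [h2]
    have hcd := measurable_enorm_mul_dualAct (H := H) hc
    rw [lintegral_lintegral_swap hcd.aemeasurable]
    have h3 : ∀ᵐ ξ : E d, ∫⁻ h : H,
        (‖𝓕 ψ ξ‖ₑ ^ 2 * ‖𝓕 ψ (dualAct (h : GL (Fin d) ℝ) ξ)‖ₑ ^ 2) ∂μ =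
        ‖𝓕 ψ ξ‖ₑ ^ 2 * ∫⁻ h : H, ‖𝓕 ψ (dualAct (h : GL (Fin d) ℝ) ξ₀)‖ₑ ^ 2 ∂μ := by
      have hnull := hH.irreducible.volume_compl_eq_zero hO.1 hO.nonempty hO.isDualInvariant
      filter_upwards [compl_mem_ae_iff.2 hnull] with ξ hξ
      rw [compl_compl] at hξ
      rw [lintegral_const_mul' _ _ (by simp)]
      congr 1
      exact hO.lintegral_eq μ hξ₀ hξ (fun η => ‖𝓕 ψ η‖ₑ ^ 2)
    rw [lintegral_congr_ae h3, lintegral_mul_const' _ _ hfin.ne, ← eLpNorm_two_sq]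
    exact ENNReal.mul_lt_top (ENNReal.pow_lt_top hF2.2) hfin
  exact (ENNReal.pow_lt_top_iff.1 hkey).resolve_right (by norm_num)

end Wavelet

/-! ### Continuous distributional derivatives are classical derivatives. -/

namespace Wavelet

open Filter Topology
open scoped Convolution

variable {d : ℕ}

theorem partialDeriv_succ_left {n : ℕ} (v : Fin (n + 1) → Fin d) {φ : E d → ℂ}
    (hφ : ContDiff ℝ ∞ φ) (x : E d) :
    partialDeriv v φ x = fderiv ℝ (partialDeriv (fun j => v j.succ) φ) x
      (EuclideanSpace.single (v 0) (1 : ℝ)) := by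
  have hdiff : DifferentiableAt ℝ (iteratedFDeriv ℝ n φ) x :=
    (hφ.differentiable_iteratedFDeriv (by exact_mod_cast ENat.natCast_lt_top n)) x
  have h1 : HasFDerivAt (partialDeriv (fun j => v j.succ) φ)
      ((ContinuousMultilinearMap.apply ℝ (fun _ : Fin n => E d) ℂ
        (fun j => EuclideanSpace.single (v j.succ) (1 : ℝ))).comp
          (fderiv ℝ (iteratedFDeriv ℝ n φ) x)) x :=
    (ContinuousMultilinearMap.apply ℝ (fun _ : Fin n => E d) ℂ
      (fun j => EuclideanSpace.single (v j.succ) (1 : ℝ))).hasFDerivAt.comp x hdiff.hasFDerivAt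
  rw [h1.fderiv, partialDeriv, iteratedFDeriv_succ_apply_left]
  rfl

theorem contDiff_partialDeriv {n : ℕ} (v : Fin n → Fin d) {φ : E d → ℂ}
    (hφ : ContDiff ℝ ∞ φ) : ContDiff ℝ ∞ (partialDeriv v φ) :=
  (ContinuousMultilinearMap.apply ℝ (fun _ : Fin n => E d) ℂ
    (fun j => EuclideanSpace.single (v j) (1 : ℝ))).contDiff.comp
    (hφ.iteratedFDeriv_right (by exact_mod_cast le_top))

theorem hasCompactSupport_partialDeriv {n : ℕ} (v : Fin n → Fin d) {φ : E d → ℂ}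
    (hφ : HasCompactSupport φ) : HasCompactSupport (partialDeriv v φ) :=
  (hφ.iteratedFDeriv n).comp_left (g := fun m : ContinuousMultilinearMap ℝ (fun _ : Fin n => E d) ℂ
    => m (fun j => EuclideanSpace.single (v j) (1 : ℝ))) rfl

theorem partialDeriv_zero (v : Fin 0 → Fin d) (f : E d → ℂ) : partialDeriv v f = f := by
  funext x; simp [partialDeriv]

theorem partialDeriv_one (v : Fin 1 → Fin d) (f : E d → ℂ) (x : E d) :
    partialDeriv v f x = fderiv ℝ f x (EuclideanSpace.single (v 0) (1 : ℝ)) := by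
  simp [partialDeriv]

/-- A distributional derivative of order zero which is continuous is the function itself. -/
theorem eq_of_isDistribDeriv_zero {v : Fin 0 → Fin d} {f g : E d → ℂ} (hf : Continuous f)
    (hg : Continuous g) (h : IsDistribDeriv v f g) : f = g := by
  refine (Continuous.ae_eq_iff_eq volume hf hg).1
    (ae_eq_of_integral_contDiff_smul_eq hf.locallyIntegrable hg.locallyIntegrable
      fun φ hφ hc => ?_)
  have h1 : HasCompactSupport (fun x => (φ x : ℂ)) := hc.comp_left Complex.ofReal_zero
  have h2 : ContDiff ℝ ∞ (fun x => (φ x : ℂ)) := Complex.ofRealCLM.contDiff.comp hφ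
  simpa [partialDeriv_zero, mul_comm] using h _ h2 h1

/-- Distributional derivatives compose. -/
theorem IsDistribDeriv.of_succ {n : ℕ} {v : Fin (n + 1) → Fin d} {f f₁ g : E d → ℂ}
    (h1 : IsDistribDeriv (fun _ : Fin 1 => v 0) f f₁) (h : IsDistribDeriv v f g) :
    IsDistribDeriv (fun j => v j.succ) f₁ g := by
  intro φ hφ hc
  have h2 := h1 (partialDeriv (fun j => v j.succ) φ) (contDiff_partialDeriv _ hφ)
    (hasCompactSupport_partialDeriv _ hc)
  have h3 := h φ hφ hc
  simp only [partialDeriv_one] at h2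
  simp only [partialDeriv_succ_left v hφ] at h3
  rw [h2] at h3
  linear_combination -h3

/-- The derivative of the mollification of a function with continuous distributional first order
derivatives. -/
theorem hasFDerivAt_bump_convolution {f : E d → ℂ} (hf : Continuous f) {g : Fin d → E d → ℂ}
    (h : ∀ i, IsDistribDeriv (fun _ : Fin 1 => i) f (g i))
    (ρ : ContDiffBump (0 : E d)) (x : E d) :
    HasFDerivAt (ρ.normed volume ⋆[ContinuousLinearMap.lsmul ℝ ℝ, volume] f)
      (∑ i, (EuclideanSpace.proj i : E d →L[ℝ] ℝ).smulRight
        ((ρ.normed volume ⋆[ContinuousLinearMap.lsmul ℝ ℝ, volume] g i) x)) x := by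
  have hρ : ContDiff ℝ ∞ (ρ.normed volume) := ρ.contDiff_normed
  have hρc : HasCompactSupport (ρ.normed volume) := ρ.hasCompactSupport_normed
  have hρ1 : ContDiff ℝ 1 (ρ.normed volume) := ρ.contDiff_normed
  have h1 := hρc.hasFDerivAt_convolution_right
    (ContinuousLinearMap.lsmul ℝ ℝ : ℝ →L[ℝ] ℂ →L[ℝ] ℂ).flip hf.locallyIntegrable
    (μ := (volume : Measure (E d))) hρ1 x
  rw [convolution_flip] at h1
  convert! h1 using 1
  refine ContinuousLinearMap.coe_injective
    ((EuclideanSpace.basisFun (Fin d) ℝ).toBasis.ext fun i => ?_)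
  simp only [OrthonormalBasis.coe_toBasis, EuclideanSpace.basisFun_apply,
    ContinuousLinearMap.coe_coe]
  rw [convolution_precompR_apply _ hf.locallyIntegrable (hρc.fderiv ℝ)
    (hρ1.continuous_fderiv one_ne_zero)]
  have hproj : ∀ j, (EuclideanSpace.proj j : E d →L[ℝ] ℝ) (EuclideanSpace.single i (1 : ℝ)) =
      if j = i then 1 else 0 := fun j => PiLp.single_apply 2 ℝ i 1 j
  simp only [_root_.sum_apply, ContinuousLinearMap.smulRight_apply, hproj, ite_smul, one_smul,
    zero_smul]
  rw [Finset.sum_ite_eq' Finset.univ i, if_pos (Finset.mem_univ i)]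
  -- The test function is `y ↦ ρ(x - y)`; the sign from the inner derivative cancels the sign of
  -- integration by parts.
  have hφ : ContDiff ℝ ∞ fun y => ((ρ.normed volume (x - y) : ℝ) : ℂ) :=
    Complex.ofRealCLM.contDiff.comp (hρ.comp (contDiff_const.sub contDiff_id))
  have hφc : HasCompactSupport fun y => ((ρ.normed volume (x - y) : ℝ) : ℂ) :=
    (hρc.comp_homeomorph (Homeomorph.subLeft x)).comp_left Complex.ofReal_zero
  have h2 := h i _ hφ hφc
  have h3 : ∀ y, partialDeriv (fun _ : Fin 1 => i) (fun y => ((ρ.normed volume (x - y) : ℝ) : ℂ)) y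
      = -((fderiv ℝ (ρ.normed volume) (x - y) (EuclideanSpace.single i (1 : ℝ)) : ℝ) : ℂ) := by
    intro y
    have h4 : HasFDerivAt (fun y : E d => x - y) (-ContinuousLinearMap.id ℝ (E d)) y :=
      (hasFDerivAt_id y).const_sub x
    have h5 := (hρ1.differentiable one_ne_zero (x - y)).hasFDerivAt.comp y h4
    have h6 := Complex.ofRealCLM.hasFDerivAt.comp y h5
    have h7 : HasFDerivAt (fun y => ((ρ.normed volume (x - y) : ℝ) : ℂ)) _ y := h6
    rw [partialDeriv_one, h7.fderiv]
    simp
  simp_rw [h3] at h2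
  rw [convolution_eq_swap, convolution_def]
  simp only [ContinuousLinearMap.lsmul_apply, ContinuousLinearMap.flip_apply, Complex.real_smul]
  simp only [pow_one, mul_neg, integral_neg, neg_mul, one_mul, neg_inj] at h2
  simp_rw [mul_comm] at h2 ⊢
  exact h2.symm

/-- A continuous function with continuous distributional first order derivatives is
differentiable. -/
theorem hasFDerivAt_of_isDistribDeriv {f : E d → ℂ} (hf : Continuous f) {g : Fin d → E d → ℂ}
    (hg : ∀ i, Continuous (g i)) (h : ∀ i, IsDistribDeriv (fun _ : Fin 1 => i) f (g i)) (x : E d) :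
    HasFDerivAt f (∑ i, (EuclideanSpace.proj i : E d →L[ℝ] ℝ).smulRight (g i x)) x := by
  let ρ : ℕ → ContDiffBump (0 : E d) := fun n =>
    ⟨1 / ((n : ℝ) + 1), 2 / ((n : ℝ) + 1), by positivity,
      by gcongr; norm_num⟩
  have hρ : Tendsto (fun n => (ρ n).rOut) atTop (𝓝 0) :=
    tendsto_const_div_atTop_nhds_zero_nat 2 |>.comp (tendsto_add_atTop_nat 1) |>.congr
      fun n => by simp [ρ]
  have hconv : ∀ i, Tendsto (fun q : ℕ × E d =>
      ((ρ q.1).normed volume ⋆[ContinuousLinearMap.lsmul ℝ ℝ, volume] g i) q.2)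
      (atTop ×ˢ 𝓝 x) (𝓝 (g i x)) := fun i =>
    ContDiffBump.convolution_tendsto_right (φ := fun q : ℕ × E d => ρ q.1) (g := fun _ => g i)
      (k := Prod.snd) (hρ.comp tendsto_fst)
      (Eventually.of_forall fun _ => (hg i).aestronglyMeasurable)
      (((hg i).tendsto x).comp tendsto_snd) tendsto_snd
  have hcont : ∀ {α : Type} {l : Filter α} {u : Fin d → α → ℂ},
      (∀ i, Tendsto (u i) l (𝓝 (g i x))) →
      Tendsto (fun a => ∑ i, (EuclideanSpace.proj i : E d →L[ℝ] ℝ).smulRight (u i a)) l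
        (𝓝 (∑ i, (EuclideanSpace.proj i : E d →L[ℝ] ℝ).smulRight (g i x))) := by
    intro α l u hu
    refine tendsto_finsetSum _ fun i _ => ?_
    exact ((ContinuousLinearMap.smulRightL ℝ (E d) ℂ (EuclideanSpace.proj i)).continuous.tendsto
      _).comp (hu i)
  refine hasFDerivAt_of_tendstoUniformlyOnFilter (l := atTop)
    (f := fun n => (ρ n).normed volume ⋆[ContinuousLinearMap.lsmul ℝ ℝ, volume] f)
    (f' := fun n y => ∑ i, (EuclideanSpace.proj i : E d →L[ℝ] ℝ).smulRight
        (((ρ n).normed volume ⋆[ContinuousLinearMap.lsmul ℝ ℝ, volume] g i) y))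
    (g' := fun y => ∑ i, (EuclideanSpace.proj i : E d →L[ℝ] ℝ).smulRight (g i y))
    ?_ (Eventually.of_forall fun n => hasFDerivAt_bump_convolution hf h _ _)
    (Eventually.of_forall fun y =>
      ContDiffBump.convolution_tendsto_right_of_continuous hρ hf y)
  -- Near `x` both the limit derivative and the mollified ones tend to the same value, so the pair
  -- approaches a diagonal point, hence the uniformity.
  rw [tendstoUniformlyOnFilter_iff_tendsto]
  refine Tendsto.mono_right ?_ (nhds_le_uniformity
    (∑ i, (EuclideanSpace.proj i : E d →L[ℝ] ℝ).smulRight (g i x)))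
  refine Tendsto.prodMk_nhds ?_ (hcont hconv)
  exact hcont fun i => ((hg i).tendsto x).comp tendsto_snd

/-- A continuous function whose distributional derivatives of order at most `t` are continuous is
of class `C^t`, and its classical derivatives are the distributional ones. -/
theorem contDiff_of_isDistribDeriv (t : ℕ) : ∀ {f : E d → ℂ}, Continuous f →
    (∀ n ≤ t, ∀ v : Fin n → Fin d, ∃ g : E d → ℂ, Continuous g ∧ IsDistribDeriv v f g) →
    ContDiff ℝ t f ∧ ∀ n ≤ t, ∀ (v : Fin n → Fin d) (g : E d → ℂ), Continuous g →
      IsDistribDeriv v f g → g = partialDeriv (fun j => v j.rev) f := by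
  induction t with
  | zero =>
    intro f hf _
    refine ⟨by exact_mod_cast contDiff_zero.2 hf, fun n hn v g hg hv => ?_⟩
    obtain rfl := Nat.le_zero.1 hn
    rw [partialDeriv_zero, eq_of_isDistribDeriv_zero hf hg hv]
  | succ t ih =>
    intro f hf H
    choose f₁ hf₁c hf₁ using fun i : Fin d => H 1 (by omega) (fun _ => i)
    have hder := hasFDerivAt_of_isDistribDeriv hf hf₁c hf₁
    have hIH := fun i => ih (hf₁c i) fun n hn w => by
      obtain ⟨g, hg, hgd⟩ := H (n + 1) (by omega) (Fin.cons i w)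
      refine ⟨g, hg, ?_⟩
      have := IsDistribDeriv.of_succ (f₁ := f₁ i) (by simpa using hf₁ i) hgd
      simpa using this
    have hfd : fderiv ℝ f = fun x =>
        ∑ i, (EuclideanSpace.proj i : E d →L[ℝ] ℝ).smulRight (f₁ i x) :=
      funext fun x => (hder x).fderiv
    have hC : ContDiff ℝ ((t + 1 : ℕ) : WithTop ℕ∞) f := by
      rw [Nat.cast_add, Nat.cast_one, contDiff_succ_iff_fderiv]
      refine ⟨fun x => (hder x).differentiableAt, by simp, ?_⟩
      rw [hfd]
      exact ContDiff.sum fun i _ =>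
        (ContinuousLinearMap.smulRightL ℝ (E d) ℂ (EuclideanSpace.proj i)).contDiff.comp (hIH i).1
    refine ⟨hC, fun n hn v g hg hv => ?_⟩
    cases n with
    | zero => rw [partialDeriv_zero, eq_of_isDistribDeriv_zero hf hg hv]
    | succ n =>
      -- The recursion removes `v 0` first, as the innermost derivative, whereas an iterated Fréchet
      -- derivative has its innermost direction in the last slot. This is the source of `Fin.rev`,
      -- and it avoids any use of symmetry of derivatives.
      have h1 := (hIH (v 0)).2 n (by omega) (fun j => v j.succ) g hg
        (IsDistribDeriv.of_succ (hf₁ (v 0)) hv)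
      rw [h1]
      funext x
      have h2 : f₁ (v 0) = ContinuousLinearMap.apply ℝ ℂ (EuclideanSpace.single (v 0) (1 : ℝ)) ∘
          fderiv ℝ f := by
        funext y
        simp [hfd]
      have h3 : ContDiffAt ℝ n (fderiv ℝ f) x :=
        (hC.fderiv_right (m := n) (by exact_mod_cast hn)).contDiffAt
      rw [partialDeriv, partialDeriv, h2, ContinuousLinearMap.iteratedFDeriv_comp_left _ h3 le_rfl,
        iteratedFDeriv_succ_apply_right]
      have h5 : (Fin.init fun j : Fin (n + 1) => (EuclideanSpace.single (v j.rev) (1 : ℝ) : E d)) =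
          fun j => EuclideanSpace.single (v j.rev.succ) (1 : ℝ) := by
        funext j; simp [Fin.init, Fin.rev_castSucc]
      rw [h5, Fin.rev_last]
      rfl

end Wavelet

/-! ### Decay governed by `A`, and part 1 of the theorem. -/

namespace Wavelet

variable {d : ℕ}

/-- The norm of a multilinear map is controlled by its values on the standard basis. -/
theorem norm_multilinear_le_sum {n : ℕ} (m : ContinuousMultilinearMap ℝ (fun _ : Fin n => E d) ℂ) :
    ‖m‖ ≤ ∑ v : Fin n → Fin d, ‖m fun j => EuclideanSpace.single (v j) (1 : ℝ)‖ := by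
  refine ContinuousMultilinearMap.opNorm_le_bound (by positivity) fun x => ?_
  have hx : x = fun j => ∑ i, x j i • (EuclideanSpace.single i (1 : ℝ) : E d) := by
    funext j
    exact (((EuclideanSpace.basisFun (Fin d) ℝ).sum_repr (x j)).symm.trans (by simp))
  have h1 : m x = ∑ v : Fin n → Fin d, m fun j =>
      x j (v j) • (EuclideanSpace.single (v j) (1 : ℝ) : E d) := by
    conv_lhs => rw [hx]
    exact m.map_sum (fun j i => x j i • (EuclideanSpace.single i (1 : ℝ) : E d))
  rw [h1, Finset.sum_mul]
  refine (norm_sum_le _ _).trans (Finset.sum_le_sum fun v _ => ?_)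
  rw [m.map_smul_univ, norm_smul, mul_comm, norm_prod]
  gcongr with j
  exact PiLp.norm_apply_le (x j) (v j)

/-- Taylor estimate at a point where all derivatives of order less than `t` vanish. -/
theorem norm_le_of_iteratedFDeriv_eq_zero {t : ℕ} {f : E d → ℂ} (hf : ContDiff ℝ t f) {η ξ : E d}
    (h0 : ∀ k < t, iteratedFDeriv ℝ k f η = 0) {M : ℝ}
    (hM : ∀ z ∈ segment ℝ η ξ, ‖iteratedFDeriv ℝ t f z‖ ≤ M) : ‖f ξ‖ ≤ M * ‖ξ - η‖ ^ t := by
  have hM0 : 0 ≤ M := (norm_nonneg _).trans (hM η (left_mem_segment ℝ η ξ))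
  -- Descend from order `t` to order `0`, gaining one factor `‖z - η‖` per application of the mean
  -- value inequality. The factorial of Taylor's formula is not needed.
  have key : ∀ k ≤ t, ∀ z ∈ segment ℝ η ξ, ‖iteratedFDeriv ℝ (t - k) f z‖ ≤ M * ‖z - η‖ ^ k := by
    intro k
    induction k with
    | zero => intro _ z hz; simpa using hM z hz
    | succ k ih =>
      intro hk z hz
      have hsub : segment ℝ η z ⊆ segment ℝ η ξ :=
        (convex_segment η ξ).segment_subset (left_mem_segment ℝ η ξ) hz
      have hlt : t - (k + 1) < t := by omega
      have h1 := Convex.norm_image_sub_le_of_norm_fderiv_le (𝕜 := ℝ)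
        (f := iteratedFDeriv ℝ (t - (k + 1)) f) (C := M * ‖z - η‖ ^ k) (s := segment ℝ η z)
        (x := η) (y := z)
        (fun w _ => hf.differentiable_iteratedFDeriv (by exact_mod_cast hlt) w)
        (fun w hw => by
          rw [norm_fderiv_iteratedFDeriv, show t - (k + 1) + 1 = t - k by omega]
          refine (ih (by omega) w (hsub hw)).trans ?_
          gcongr
          obtain ⟨a, b, ha, hb, hab, rfl⟩ := hw
          have : a • η + b • z - η = b • (z - η) := by
            rw [show a = 1 - b by linarith, sub_smul, smul_sub, one_smul]; abel
          rw [this, norm_smul, Real.norm_of_nonneg hb]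
          exact mul_le_of_le_one_left (norm_nonneg _) (by linarith))
        (convex_segment η z) (left_mem_segment ℝ η z) (right_mem_segment ℝ η z)
      rw [h0 _ hlt, sub_zero] at h1
      rw [pow_succ, ← mul_assoc]
      exact h1
  have h2 := key t le_rfl ξ (right_mem_segment ℝ η ξ)
  rwa [Nat.sub_self, norm_iteratedFDeriv_zero] at h2

/-- The point of a cone nearest to `ξ` is the orthogonal projection of `ξ` on its line. -/
theorem inner_sub_eq_zero_of_cone {C : Set (E d)} (hC : ∀ (c : ℝ), ∀ ξ ∈ C, c • ξ ∈ C)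
    {ξ η : E d} (hη : η ∈ C) (hdist : Metric.infDist ξ C = dist ξ η) :
    inner ℝ η (ξ - η) = 0 := by
  rcases eq_or_ne η 0 with rfl | hη0
  · simp
  set p : ℝ := inner ℝ η (ξ - η) with hp
  have hpos : 0 < ‖η‖ ^ 2 := by positivity
  -- The competitor is the orthogonal projection of `ξ` onto the line of `η`, which lies in the
  -- cone.
  have h1 : dist ξ η ≤ dist ξ ((1 + p / ‖η‖ ^ 2) • η) :=
    hdist ▸ Metric.infDist_le_dist_of_mem (hC _ _ hη)
  rw [dist_eq_norm, dist_eq_norm] at h1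
  have h2 : ξ - (1 + p / ‖η‖ ^ 2) • η = (ξ - η) - (p / ‖η‖ ^ 2) • η := by
    rw [add_smul, one_smul]; abel
  have h3 := pow_le_pow_left₀ (norm_nonneg _) h1 2
  rw [h2, norm_sub_sq_real (ξ - η), inner_smul_right, norm_smul, mul_pow, real_inner_comm, ← hp,
    Real.norm_eq_abs, sq_abs] at h3
  have h4 : (p / ‖η‖ ^ 2) ^ 2 * ‖η‖ ^ 2 = p ^ 2 / ‖η‖ ^ 2 := by field_simp
  have h5 : p / ‖η‖ ^ 2 * p = p ^ 2 / ‖η‖ ^ 2 := by ring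
  rw [h4, h5] at h3
  have h6 : p ^ 2 / ‖η‖ ^ 2 ≤ 0 := by linarith
  have h7 : p ^ 2 ≤ 0 := by
    rwa [div_le_iff₀ hpos, zero_mul] at h6
  exact pow_eq_zero_iff two_ne_zero |>.1 (le_antisymm h7 (sq_nonneg p))

theorem auxA_nonneg (O : Set (E d)) (ξ : E d) : 0 ≤ auxA O ξ :=
  le_min (div_nonneg Metric.infDist_nonneg (by positivity)) (by positivity)

theorem auxA_le_one (O : Set (E d)) (ξ : E d) : auxA O ξ ≤ 1 :=
  (min_le_right _ _).trans (by
    rw [div_le_one (by positivity)]; linarith [norm_nonneg ξ])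

/-- Decay of functions whose derivatives vanish on the complement of `O`. -/
theorem exists_norm_le_auxA_pow {O : Set (E d)} (hO : IsOpen O) (h0 : (0 : E d) ∈ Oᶜ)
    (hcone : ∀ (c : ℝ), ∀ ξ ∈ Oᶜ, c • ξ ∈ Oᶜ) {t : ℕ} {f : E d → ℂ} (hf : ContDiff ℝ t f) {M : ℝ}
    (hM : ∀ n ≤ t, ∀ (v : Fin n → Fin d) (x : E d),
      (1 + ‖x‖) ^ t * ‖partialDeriv v f x‖ ≤ M)
    (hvan : ∀ n < t, ∀ (v : Fin n → Fin d), ∀ x ∈ Oᶜ, partialDeriv v f x = 0) :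
    ∃ C : ℝ, ∀ ξ, ‖f ξ‖ ≤ C * auxA O ξ ^ t := by
  have hbound : ∀ n ≤ t, ∀ (v : Fin n → Fin d) (x : E d),
      ‖partialDeriv v f x‖ ≤ M / (1 + ‖x‖) ^ t := fun n hn v x => by
    rw [le_div_iff₀ (by positivity), mul_comm]; exact hM n hn v x
  have hM0 : 0 ≤ M := le_trans (by positivity) (hM 0 (Nat.zero_le _) Fin.elim0 0)
  set K : ℝ := Fintype.card (Fin t → Fin d) * M with hK
  have hK0 : 0 ≤ K := by positivity
  have hderiv : ∀ x, ‖iteratedFDeriv ℝ t f x‖ ≤ K / (1 + ‖x‖) ^ t := by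
    intro x
    refine (norm_multilinear_le_sum _).trans
      ((Finset.sum_le_sum fun v _ => hbound t le_rfl v x).trans (le_of_eq ?_))
    rw [Finset.sum_const, Finset.card_univ, nsmul_eq_mul, hK, mul_div_assoc]
  refine ⟨max K M, fun ξ => ?_⟩
  have h1 : ‖f ξ‖ ≤ max K M * (1 / (1 + ‖ξ‖)) ^ t := by
    have := hbound 0 (Nat.zero_le _) Fin.elim0 ξ
    rw [partialDeriv_zero] at this
    rw [div_pow, one_pow, mul_one_div]
    refine this.trans ?_
    gcongr
    exact le_max_right _ _
  obtain ⟨η, hη, hdist⟩ := hO.isClosed_compl.exists_infDist_eq_dist ⟨0, h0⟩ ξ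
  have horth := inner_sub_eq_zero_of_cone hcone hη hdist
  have hsq : ‖ξ‖ ^ 2 = ‖η‖ ^ 2 + ‖ξ - η‖ ^ 2 := by
    have := norm_add_sq_real η (ξ - η)
    rw [horth, add_sub_cancel] at this
    linarith
  have hsqrt : Real.sqrt (‖ξ‖ ^ 2 - Metric.infDist ξ Oᶜ ^ 2) = ‖η‖ := by
    rw [hdist, dist_eq_norm, hsq, add_sub_cancel_right, Real.sqrt_sq (norm_nonneg _)]
  have h2 : ‖f ξ‖ ≤ max K M *
      (Metric.infDist ξ Oᶜ / (1 + Real.sqrt (‖ξ‖ ^ 2 - Metric.infDist ξ Oᶜ ^ 2))) ^ t := by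
    rw [hsqrt, hdist, dist_eq_norm, div_pow, mul_div_assoc', mul_div_right_comm]
    refine (norm_le_of_iteratedFDeriv_eq_zero hf (η := η) (fun k hk => ?_)
      (M := K / (1 + ‖η‖) ^ t) fun z hz => ?_).trans ?_
    · have h3 := norm_multilinear_le_sum (iteratedFDeriv ℝ k f η)
      have h4 : ∀ v : Fin k → Fin d, iteratedFDeriv ℝ k f η
          (fun j => EuclideanSpace.single (v j) (1 : ℝ)) = 0 := fun v => hvan k hk v η hη
      simp only [h4, norm_zero, Finset.sum_const_zero] at h3
      exact norm_le_zero_iff.1 h3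
    · refine (hderiv z).trans ?_
      -- Pythagoras for `z = η + b (ξ - η)`; thus the derivative bound along the whole segment is
      -- governed by `1 + ‖η‖`.
      have h5 : ‖η‖ ≤ ‖z‖ := by
        obtain ⟨a, b, ha, hb, hab, rfl⟩ := hz
        have h6 : a • η + b • ξ = η + b • (ξ - η) := by
          rw [show a = 1 - b by linarith, sub_smul, smul_sub, one_smul]; abel
        have h7 := norm_add_sq_real η (b • (ξ - η))
        rw [inner_smul_right, horth] at h7
        rw [h6]
        refine pow_le_pow_iff_left₀ (norm_nonneg _) (norm_nonneg _) two_ne_zero |>.1 ?_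
        rw [h7]
        nlinarith [sq_nonneg ‖b • (ξ - η)‖]
      gcongr
    · gcongr
      exact le_max_left _ _
  rcases min_choice (Metric.infDist ξ Oᶜ /
    (1 + Real.sqrt (‖ξ‖ ^ 2 - Metric.infDist ξ Oᶜ ^ 2))) (1 / (1 + ‖ξ‖)) with h | h
  · rw [auxA, h]; exact h2
  · rw [auxA, h]; exact h1

/-- Functions dominated by `A^ℓ` are square-integrable along the orbit map. -/
theorem TemperatelyEmbedded.exists_lintegral_lt_top {H : Subgroup (GL (Fin d) ℝ)}
    [MeasurableSpace H] {μ : Measure H} {O : Set (E d)} {ℓ : ℕ}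
    (hℓ : TemperatelyEmbedded H μ O 0 2 (fun _ => 1) ℓ) :
    ∃ ξ₀ ∈ O, ∀ (F : E d → ℂ) (C : ℝ), (∀ ξ, ‖F ξ‖ ≤ C * auxA O ξ ^ ℓ) →
      ∫⁻ h : H, ‖F (dualAct (h : GL (Fin d) ℝ) ξ₀)‖ₑ ^ 2 ∂μ < ⊤ := by
  obtain ⟨ξ₀, hξ₀, h1, -⟩ := hℓ
  refine ⟨ξ₀, hξ₀, fun F C hF => ?_⟩
  rw [show ENNReal.ofReal 2 = 2 by simp] at h1
  have h2 := h1.const_mul |C|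
  have h3 := ENNReal.pow_lt_top (n := 2) h2.2
  rw [eLpNorm_eq_lintegral_rpow_enorm_toReal (by norm_num) (by norm_num), ← ENNReal.rpow_natCast,
    ← ENNReal.rpow_mul] at h3
  simp only [ENNReal.toReal_ofNat, Nat.cast_ofNat, ENNReal.rpow_ofNat, one_div] at h3
  rw [inv_mul_cancel₀ two_ne_zero, ENNReal.rpow_one] at h3
  refine lt_of_le_of_lt (lintegral_mono fun h => ?_) h3
  refine pow_le_pow_left₀ (by positivity) (enorm_le_iff_norm_le.2 ?_) 2
  refine (hF _).trans ?_
  have hA := auxA_nonneg O (dualAct (h : GL (Fin d) ℝ) ξ₀)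
  -- For `q = 2` the determinant factor is `1`, and the norm weight is at least `1`, so `A^ℓ` alone
  -- is dominated by the given `L²` function.
  have h4 : (1 : ℝ) ≤ (1 + opNorm (h : GL (Fin d) ℝ)) ^ ((0 : ℝ) + d + 1) :=
    Real.one_le_rpow (by linarith [show 0 ≤ opNorm (h : GL (Fin d) ℝ) from norm_nonneg _])
      (by positivity)
  rw [Real.norm_of_nonneg (by
    refine mul_nonneg (abs_nonneg _) (mul_nonneg (mul_nonneg (mul_nonneg (by positivity) ?_)
      zero_le_one) (pow_nonneg hA _))
    linarith)]
  refine mul_le_mul (le_abs_self C) ?_ (pow_nonneg hA _) (abs_nonneg _)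
  rw [sub_self, Real.rpow_zero, one_mul, mul_one]
  exact le_mul_of_one_le_left (pow_nonneg hA _) h4

/-- A continuous function decaying like `(1 + |ξ|)^{-t}`, `t > d/2`, is square-integrable. -/
theorem memLp_two_of_decay {F : E d → ℂ} (hF : Continuous F) {t : ℕ} (ht : (d : ℝ) / 2 < t) {M : ℝ}
    (hM : ∀ x, (1 + ‖x‖) ^ t * ‖F x‖ ≤ M) : MemLp F 2 volume := by
  rw [memLp_two_iff_integrable_sq_norm hF.aestronglyMeasurable]
  have h1 : Integrable (fun x : E d => M ^ 2 * (1 + ‖x‖) ^ (-(2 * t : ℝ))) volume := by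
    refine (integrable_one_add_norm ?_).const_mul _
    rw [finrank_euclideanSpace_fin]
    linarith
  refine h1.mono' (hF.norm.pow 2).aestronglyMeasurable (ae_of_all _ fun x => ?_)
  rw [Real.norm_of_nonneg (by positivity), Real.rpow_neg (by positivity),
    show (2 * t : ℝ) = ((t * 2 : ℕ) : ℝ) by push_cast; ring, Real.rpow_natCast, pow_mul,
    ← div_eq_mul_inv, le_div_iff₀ (by positivity), ← mul_pow, mul_comm]
  exact pow_le_pow_left₀ (by positivity) (hM x) 2

/-- Vanishing moments of sufficiently high order imply admissibility. -/
theorem isAdmissibleFun_of_hasVanishingMoments (hd : 0 < d) {H : Subgroup (GL (Fin d) ℝ)}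
    [MeasurableSpace H] [BorelSpace H] {μ : Measure H} [μ.IsHaarMeasure]
    (hH : IsAdmissibleDilationGroup H μ) {O : Set (E d)} (hO : IsOpenDualOrbit H O) {ℓ : ℕ}
    (hℓ : TemperatelyEmbedded H μ O 0 2 (fun _ => 1) ℓ) {t : ℕ} {ψ : E d → ℂ}
    (ht : (ℓ : ℝ) + d / 2 + 1 < t) (hψ : HasVanishingMoments O t ψ)
    (hS : schwartzNorm t t (𝓕 ψ) < ⊤) (hne : ¬ ψ =ᵐ[volume] 0) : IsAdmissibleFun H μ ψ := by
  obtain ⟨hint, hmom⟩ := hψ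
  have hc := continuous_fourier hint
  obtain ⟨hC, hpart⟩ := contDiff_of_isDistribDeriv t hc
    fun n hn v => (hmom n hn v).imp fun g hg => ⟨hg.1, hg.2.1⟩
  have hM : ∀ n ≤ t, ∀ (v : Fin n → Fin d) (x : E d),
      (1 + ‖x‖) ^ t * ‖partialDeriv v (𝓕 ψ) x‖ ≤ (schwartzNorm t t (𝓕 ψ)).toReal := by
    intro n hn v x
    rw [← ENNReal.ofReal_le_iff_le_toReal hS.ne]
    exact le_iSup₂_of_le n hn (le_iSup₂_of_le v x le_rfl)
  have hvan : ∀ n < t, ∀ (v : Fin n → Fin d), ∀ x ∈ Oᶜ, partialDeriv v (𝓕 ψ) x = 0 := by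
    intro n hn v x hx
    -- Feeding in the reversed multi-index undoes the reversal in `contDiff_of_isDistribDeriv`.
    obtain ⟨g, hg, hgd, hg0⟩ := hmom n hn.le (fun j => v j.rev)
    have h1 := hpart n hn.le _ g hg hgd
    simp only [Fin.rev_rev] at h1
    rw [← h1]
    exact hg0 hn x hx
  obtain ⟨C, hCb⟩ := exists_norm_le_auxA_pow hO.1 (hO.zero_notMem hd)
    (fun c ξ hξ => hO.smul_mem_compl hd hH.irreducible c hξ) hC hM hvan
  obtain ⟨ξ₀, hξ₀, hfin⟩ := hℓ.exists_lintegral_lt_top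
  have hℓt : ℓ ≤ t := by
    have : (ℓ : ℝ) ≤ t := by linarith [show (0 : ℝ) ≤ d / 2 by positivity]
    exact_mod_cast this
  have hL2 : MemLp (𝓕 ψ) 2 volume := memLp_two_of_decay (t := t) hc
    (by linarith [Nat.cast_nonneg (α := ℝ) ℓ]) fun x => by
      simpa only [partialDeriv_zero] using hM 0 (Nat.zero_le _) Fin.elim0 x
  refine isAdmissibleFun_of_lintegral_lt_top hH hO hξ₀ hint
    (memLp_two_of_memLp_fourier hint hL2) hne (hfin _ |C| fun ξ => (hCb ξ).trans ?_)
  exact mul_le_mul (le_abs_self C)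
    (pow_le_pow_of_le_one (auxA_nonneg O ξ) (auxA_le_one O ξ) hℓt)
    (pow_nonneg (auxA_nonneg O ξ) _) (abs_nonneg C)

end Wavelet

/-! ### The Lie algebra of a closed group of units. -/

namespace Wavelet

section ClosedSubgroup

open Filter Topology NormedSpace

variable {𝔸 : Type*} [NormedRing 𝔸] [NormedAlgebra ℝ 𝔸]

theorem tendsto_smul_sub_one_of_hasDerivAt {γ : ℝ → 𝔸} {X : 𝔸} (h0 : γ 0 = 1)
    (hγ : HasDerivAt γ X 0) {c : ℕ → ℝ} (hc : Tendsto c atTop atTop) :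
    Tendsto (fun n => c n • (γ (c n)⁻¹ - 1)) atTop (𝓝 X) := by
  have h1 := hasDerivAt_iff_tendsto_slope_zero.1 hγ
  have h2 : Tendsto (fun n => (c n)⁻¹) atTop (𝓝[≠] 0) :=
    tendsto_nhdsWithin_iff.2 ⟨tendsto_inv_atTop_zero.comp hc,
      (hc.eventually_gt_atTop 0).mono fun n hn => (inv_pos.2 hn).ne'⟩
  refine (h1.comp h2).congr fun n => ?_
  simp [h0]

theorem hasDerivAt_exp_smul_zero [CompleteSpace 𝔸] (X : 𝔸) : HasDerivAt (fun s : ℝ => exp (s • X)) X 0 := by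
  simpa using hasDerivAt_exp_smul_const (𝕂 := ℝ) X (0 : ℝ)

variable [NormOneClass 𝔸]

omit [NormedAlgebra ℝ 𝔸] in
theorem norm_pow_sub_pow_le (a b : 𝔸) {K : ℝ} (hK : 1 ≤ K) (ha : ‖a‖ ≤ K) (hb : ‖b‖ ≤ K) (m : ℕ) :
    ‖a ^ m - b ^ m‖ ≤ m * K ^ m * ‖a - b‖ := by
  induction m with
  | zero => simp
  | succ m ih =>
    have h1 : a ^ (m + 1) - b ^ (m + 1) = a ^ m * (a - b) + (a ^ m - b ^ m) * b := by
      rw [pow_succ, pow_succ]; noncomm_ring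
    have h2 : ‖a ^ m‖ ≤ K ^ m := (norm_pow_le a m).trans (pow_le_pow_left₀ (norm_nonneg _) ha m)
    have hK0 : 0 ≤ K := by linarith
    calc ‖a ^ (m + 1) - b ^ (m + 1)‖ ≤ ‖a ^ m‖ * ‖a - b‖ + ‖a ^ m - b ^ m‖ * ‖b‖ := by
          rw [h1]
          exact (norm_add_le _ _).trans (add_le_add (norm_mul_le _ _) (norm_mul_le _ _))
      _ ≤ K ^ m * ‖a - b‖ + (m * K ^ m * ‖a - b‖) * K := by gcongr
      _ ≤ K ^ (m + 1) * ‖a - b‖ + (m * K ^ m * ‖a - b‖) * K := by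
          gcongr
          exact Nat.le_succ m
      _ = ((m + 1 : ℕ) : ℝ) * K ^ (m + 1) * ‖a - b‖ := by push_cast; ring

/-- In this form the bound survives powers: the `m`-th power of the right side is `exp (m L / c)`,
bounded when `m` is of order `c`. -/
theorem norm_le_exp_of_smul_sub_one {a : 𝔸} {c L : ℝ} (hc : 0 < c) (h : ‖c • (a - 1)‖ ≤ L) :
    ‖a‖ ≤ Real.exp (L / c) := by
  rw [norm_smul, Real.norm_of_nonneg hc.le, ← le_div_iff₀' hc] at h
  have h1 : ‖a‖ ≤ ‖a - 1‖ + 1 := by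
    simpa using norm_add_le (a - 1) (1 : 𝔸)
  linarith [Real.add_one_le_exp (L / c)]

variable [NormedAlgebra ℚ 𝔸] [CompleteSpace 𝔸]

/-- If `c_n (a_n - 1) → X` with `c_n → ∞`, then powers of `a_n` approximate `exp (t X)`. -/
theorem tendsto_pow_floor {a : ℕ → 𝔸} {c : ℕ → ℝ} {X : 𝔸} (hc : Tendsto c atTop atTop)
    (h : Tendsto (fun n => c n • (a n - 1)) atTop (𝓝 X)) {t : ℝ} (ht : 0 ≤ t) :
    Tendsto (fun n => a n ^ ⌊t * c n⌋₊) atTop (𝓝 (exp (t • X))) := by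
  -- The exact one-parameter group serves as comparison. Both sequences have the same first order
  -- behaviour, so the difference of the powers is at most `t exp(tL) ‖c(a - 1) - c(b - 1)‖`, which
  -- tends to `0`.
  set b : ℕ → 𝔸 := fun n => exp ((c n)⁻¹ • X) with hb
  have hbX : Tendsto (fun n => c n • (b n - 1)) atTop (𝓝 X) :=
    tendsto_smul_sub_one_of_hasDerivAt (by simp) (hasDerivAt_exp_smul_zero X) hc
  have hfl : Tendsto (fun n => (⌊t * c n⌋₊ : ℝ) / c n) atTop (𝓝 t) :=
    (tendsto_nat_floor_mul_div_atTop ht).comp hc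
  have hbt : Tendsto (fun n => b n ^ ⌊t * c n⌋₊) atTop (𝓝 (exp (t • X))) := by
    have h1 : Tendsto (fun n => ((⌊t * c n⌋₊ : ℝ) / c n) • X) atTop (𝓝 (t • X)) :=
      hfl.smul_const X
    refine h1.exp.congr fun n => ?_
    rw [hb, ← NormedSpace.exp_nsmul, ← Nat.cast_smul_eq_nsmul ℝ, smul_smul, div_eq_mul_inv]
  have hdiff : Tendsto (fun n => a n ^ ⌊t * c n⌋₊ - b n ^ ⌊t * c n⌋₊) atTop (𝓝 0) := by
    set L : ℝ := ‖X‖ + 1 with hL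
    have hL0 : 0 ≤ L := by positivity
    have hz : Tendsto (fun n => t * Real.exp (t * L) * ‖c n • (a n - 1) - c n • (b n - 1)‖) atTop
        (𝓝 0) := by
      simpa using (h.sub hbX).norm.const_mul (t * Real.exp (t * L))
    refine squeeze_zero_norm' ?_ hz
    filter_upwards [hc.eventually_gt_atTop 0, h.norm.eventually_le_const (lt_add_one ‖X‖),
      hbX.norm.eventually_le_const (lt_add_one ‖X‖)] with n hn h1 h2
    refine (norm_pow_sub_pow_le (a n) (b n) (Real.one_le_exp (by positivity))
      (norm_le_exp_of_smul_sub_one hn h1) (norm_le_exp_of_smul_sub_one hn h2) _).trans ?_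
    have hm : (⌊t * c n⌋₊ : ℝ) ≤ t * c n := Nat.floor_le (by positivity)
    rw [← smul_sub, norm_smul, Real.norm_of_nonneg hn.le, sub_sub_sub_cancel_right,
      ← Real.exp_nat_mul]
    have h3 : Real.exp ((⌊t * c n⌋₊ : ℝ) * (L / c n)) ≤ Real.exp (t * L) := by
      refine Real.exp_le_exp.2 ?_
      calc (⌊t * c n⌋₊ : ℝ) * (L / c n) ≤ (t * c n) * (L / c n) := by gcongr
        _ = t * L := by field_simp
    calc (⌊t * c n⌋₊ : ℝ) * Real.exp ((⌊t * c n⌋₊ : ℝ) * (L / c n)) * ‖a n - b n‖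
        ≤ (t * c n) * Real.exp (t * L) * ‖a n - b n‖ := by gcongr
      _ = t * Real.exp (t * L) * (c n * ‖a n - b n‖) := by ring
  simpa using hdiff.add hbt

/-- The closed subgroup `H` contains `exp (t X)` for `t ≥ 0` if `X` is a tangent vector. -/
theorem exists_mem_eq_exp_of_tendsto {H : Subgroup 𝔸ˣ} (hH : IsClosed (H : Set 𝔸ˣ)) {a : ℕ → 𝔸ˣ}
    (ha : ∀ n, a n ∈ H) {c : ℕ → ℝ} {X : 𝔸} (hc : Tendsto c atTop atTop)
    (h : Tendsto (fun n => c n • ((a n : 𝔸) - 1)) atTop (𝓝 X)) (t : ℝ) :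
    ∃ u ∈ H, (u : 𝔸) = exp (t • X) := by
  have key : ∀ {s : ℝ}, 0 ≤ s → ∃ u ∈ H, (u : 𝔸) = exp (s • X) := by
    intro s hs
    obtain ⟨u, hu⟩ := isUnit_exp (s • X)
    refine ⟨u, ?_, hu⟩
    have h1 : Tendsto (fun n => a n ^ ⌊s * c n⌋₊) atTop (𝓝 u) := by
      rw [Units.isOpenEmbedding_val.isInducing.tendsto_nhds_iff, hu]
      refine (tendsto_pow_floor hc h hs).congr fun n => ?_
      simp
    exact hH.mem_of_tendsto h1 (Eventually.of_forall fun n => H.pow_mem (ha n) _)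
  rcases le_total 0 t with ht | ht
  · exact key ht
  · obtain ⟨u, hu, hux⟩ := key (neg_nonneg.2 ht)
    refine ⟨u⁻¹, H.inv_mem hu, ?_⟩
    rw [Units.inv_eq_of_mul_eq_one_right]
    rw [hux, ← NormedSpace.exp_add_of_commute, ← add_smul]
    · simp
    · exact ((Commute.refl X).smul_right _).smul_left _

/-- The Lie algebra of a closed subgroup of the group of units of a Banach algebra. -/
noncomputable def lieAlg (H : Subgroup 𝔸ˣ) (hH : IsClosed (H : Set 𝔸ˣ)) : Submodule ℝ 𝔸 where
  carrier := {X | ∀ t : ℝ, ∃ u ∈ H, (u : 𝔸) = exp (t • X)}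
  zero_mem' t := ⟨1, H.one_mem, by simp⟩
  smul_mem' c X hX t := by simpa [smul_smul] using hX (t * c)
  add_mem' {X Y} hX hY := by
    choose u hu huX using hX
    choose v hv hvY using hY
    have hγ : HasDerivAt (fun s : ℝ => exp (s • X) * exp (s • Y)) (X + Y) 0 := by
      have h := (hasDerivAt_exp_smul_zero X).mul (hasDerivAt_exp_smul_zero Y)
      simp only [zero_smul, exp_zero, mul_one, one_mul] at h
      exact h
    have hc : Tendsto (fun n : ℕ => (n : ℝ)) atTop atTop := tendsto_natCast_atTop_atTop
    -- The curve `exp(sX) exp(sY)` lies in `H` and has velocity `X + Y` at `0`; sample it at `s =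
    -- 1/n`.
    refine exists_mem_eq_exp_of_tendsto hH (a := fun n => u (n : ℝ)⁻¹ * v (n : ℝ)⁻¹)
      (fun n => H.mul_mem (hu _) (hv _)) hc ?_
    refine (tendsto_smul_sub_one_of_hasDerivAt (by simp) hγ hc).congr fun n => ?_
    rw [Units.val_mul, huX, hvY]

theorem mem_lieAlg {H : Subgroup 𝔸ˣ} {hH : IsClosed (H : Set 𝔸ˣ)} {X : 𝔸} :
    X ∈ lieAlg H hH ↔ ∀ t : ℝ, ∃ u ∈ H, (u : 𝔸) = exp (t • X) := Iff.rfl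

theorem exists_exp_of_mem_lieAlg {H : Subgroup 𝔸ˣ} {hH : IsClosed (H : Set 𝔸ˣ)} {X : 𝔸}
    (hX : X ∈ lieAlg H hH) : ∃ u ∈ H, (u : 𝔸) = exp X := by
  simpa using mem_lieAlg.1 hX 1

variable [FiniteDimensional ℝ 𝔸]

/-- Small elements `Y` of a complement of the Lie algebra with `exp Y ∈ H` vanish. -/
theorem eventually_exp_mem_imp_eq_zero {H : Subgroup 𝔸ˣ} (hH : IsClosed (H : Set 𝔸ˣ))
    {N : Submodule ℝ 𝔸} (hN : Disjoint (lieAlg H hH) N) :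
    ∀ᶠ Y : N in 𝓝 0, (∃ u ∈ H, (u : 𝔸) = exp (Y : 𝔸)) → Y = 0 := by
  by_contra hcon
  rw [not_eventually] at hcon
  obtain ⟨Y, hY0, hY⟩ := exists_seq_forall_of_frequently hcon
  push Not at hY
  have hpos : ∀ n, 0 < ‖Y n‖ := fun n => norm_pos_iff.2 (hY n).2
  have hnorm : Tendsto (fun n => ‖Y n‖) atTop (𝓝[>] 0) :=
    tendsto_nhdsWithin_iff.2 ⟨by simpa using hY0.norm, Eventually.of_forall hpos⟩
  have hc : Tendsto (fun n => ‖Y n‖⁻¹) atTop atTop := tendsto_inv_nhdsGT_zero.comp hnorm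
  -- Were there nonzero `Y n → 0` in `N` with `exp (Y n)` in `H`, a limit of their directions would
  -- be a unit vector of `N` tangent to `H`.
  have hsph : ∀ n, ‖Y n‖⁻¹ • Y n ∈ Metric.sphere (0 : N) 1 := fun n => by
    rw [mem_sphere_zero_iff_norm, norm_smul, norm_inv, norm_norm, inv_mul_cancel₀ (hpos n).ne']
  obtain ⟨Z, hZ, φ, hφ, hlim⟩ := (isCompact_sphere (0 : N) 1).tendsto_subseq hsph
  have hlim' : Tendsto (fun n => ‖Y (φ n)‖⁻¹ • (Y (φ n) : 𝔸)) atTop (𝓝 (Z : 𝔸)) :=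
    (continuous_subtype_val.tendsto Z).comp hlim
  choose u hu hue using fun n => (hY n).1
  have hZmem : (Z : 𝔸) ∈ lieAlg H hH := by
    refine exists_mem_eq_exp_of_tendsto hH (a := fun n => u (φ n)) (fun n => hu _)
      (hc.comp hφ.tendsto_atTop) ?_
    have hd := (hasFDerivAt_exp_zero (𝕂 := ℝ) (𝔸 := 𝔸)).isLittleO
    have hYc : Tendsto (fun n => (Y (φ n) : 𝔸)) atTop (𝓝 0) :=
      (continuous_subtype_val.tendsto (0 : N)).comp (hY0.comp hφ.tendsto_atTop)
    have hd2 := hd.comp_tendsto hYc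
    have hd3 : Tendsto (fun n => ‖Y (φ n)‖⁻¹ • (exp (Y (φ n) : 𝔸) - 1 - (Y (φ n) : 𝔸))) atTop
        (𝓝 0) := by
      refine hd2.norm_right.tendsto_inv_smul_nhds_zero.congr fun n => ?_
      simp
    have := hd3.add hlim'
    rw [zero_add] at this
    refine this.congr fun n => ?_
    rw [← smul_add, sub_add_cancel]
    simp only [Function.comp_apply, hue]
  have hZ0 : (Z : 𝔸) = 0 := (Submodule.disjoint_def.1 hN) _ hZmem Z.2
  have : ‖Z‖ = 1 := mem_sphere_zero_iff_norm.1 hZ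
  rw [Submodule.coe_eq_zero.1 hZ0, norm_zero] at this
  exact zero_ne_one this

end ClosedSubgroup

end Wavelet

/-! ### Open orbits and infinitesimal transitivity. -/

namespace Wavelet

section ClosedSubgroup

open Filter Topology NormedSpace

variable {𝔸 : Type*} [NormedRing 𝔸] [NormedAlgebra ℝ 𝔸] [NormedAlgebra ℚ 𝔸] [CompleteSpace 𝔸]
variable {V : Type*} [NormedAddCommGroup V] [NormedSpace ℝ V]

omit [NormedAlgebra ℚ 𝔸] in
/-- The one-parameter group generated by `S` fixes the vectors annihilated by `S`. -/
theorem exp_apply_of_apply_eq_zero {ρ : 𝔸 →L[ℝ] V →L[ℝ] V} (hρ1 : ∀ v, ρ 1 v = v)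
    (hρ : ∀ a b v, ρ (a * b) v = ρ b (ρ a v)) {S : 𝔸} {v : V} (hS : ρ S v = 0) :
    ρ (exp S) v = v := by
  have h1 := (exp_series_hasSum_exp' (𝕂 := ℝ) S).mapL
    ((ContinuousLinearMap.apply ℝ V v).comp ρ)
  have h2 := hasSum_single (f := fun n : ℕ =>
    ((ContinuousLinearMap.apply ℝ V v).comp ρ) ((n.factorial : ℝ)⁻¹ • S ^ n)) 0 (by
      intro n hn
      obtain ⟨m, rfl⟩ := Nat.exists_eq_succ_of_ne_zero hn
      simp [pow_succ', hρ, hS])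
  have h3 := h1.unique h2
  simpa [hρ1] using h3

variable [NormOneClass 𝔸] [FiniteDimensional ℝ 𝔸]

/-- If the Lie algebra of `H` maps `η` onto `V`, then the orbit of `η` is a neighbourhood
of `η`. -/
theorem orbit_mem_nhds [CompleteSpace V] {ρ : 𝔸 →L[ℝ] V →L[ℝ] V} (hρ1 : ∀ v, ρ 1 v = v)
    {H : Subgroup 𝔸ˣ} (hH : IsClosed (H : Set 𝔸ˣ)) {η : V}
    (hsurj : ∀ v, ∃ X ∈ lieAlg H hH, ρ X η = v) : {w | ∃ u ∈ H, ρ (u : 𝔸) η = w} ∈ 𝓝 η := by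
  set L : 𝔸 →L[ℝ] V := (ContinuousLinearMap.apply ℝ V η).comp ρ with hL
  set F : lieAlg H hH → V := fun X => L (exp (X : 𝔸)) with hF
  have hexp : HasStrictFDerivAt (exp : 𝔸 → 𝔸) (1 : 𝔸 →L[ℝ] 𝔸)
      ((lieAlg H hH).subtypeL 0) := hasStrictFDerivAt_exp_zero
  have h1 : HasStrictFDerivAt F (L.comp ((1 : 𝔸 →L[ℝ] 𝔸).comp (lieAlg H hH).subtypeL)) 0 :=
    L.hasStrictFDerivAt.comp 0 (hexp.comp 0 (lieAlg H hH).subtypeL.hasStrictFDerivAt)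
  have h2 := h1.map_nhds_eq_of_surj (by
    rw [LinearMap.range_eq_top]
    intro v
    obtain ⟨X, hX, hXv⟩ := hsurj v
    exact ⟨⟨X, hX⟩, hXv⟩)
  have h3 : F 0 = η := by simp [hF, hL, hρ1]
  rw [h3] at h2
  rw [← h2, mem_map]
  refine univ_mem' fun X => ?_
  obtain ⟨u, hu, hux⟩ := exists_exp_of_mem_lieAlg X.2
  exact ⟨u, hu, by rw [hux]; rfl⟩

omit [NormedAlgebra ℚ 𝔸] [NormOneClass 𝔸] [FiniteDimensional ℝ 𝔸] in
theorem hasStrictFDerivAt_exp_mul_exp_mul_exp {W₁ W₂ W₃ : Type*} [NormedAddCommGroup W₁]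
    [NormedSpace ℝ W₁] [NormedAddCommGroup W₂] [NormedSpace ℝ W₂] [NormedAddCommGroup W₃]
    [NormedSpace ℝ W₃] (i₁ : W₁ →L[ℝ] 𝔸) (i₂ : W₂ →L[ℝ] 𝔸) (i₃ : W₃ →L[ℝ] 𝔸) :
    HasStrictFDerivAt (fun p : W₁ × W₂ × W₃ => exp (i₁ p.1) * (exp (i₂ p.2.1) * exp (i₃ p.2.2)))
      (i₁.coprod (i₂.coprod i₃)) 0 := by
  have hexp : ∀ (i : W₁ × W₂ × W₃ →L[ℝ] 𝔸), HasStrictFDerivAt (fun p => exp (i p)) i 0 := by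
    intro i
    have h : HasStrictFDerivAt (exp : 𝔸 → 𝔸) (1 : 𝔸 →L[ℝ] 𝔸) (i 0) := by
      rw [map_zero]; exact hasStrictFDerivAt_exp_zero
    exact h.comp 0 i.hasStrictFDerivAt
  have h1 := hexp (i₁.comp (ContinuousLinearMap.fst ℝ _ _))
  have h2 := hexp (i₂.comp ((ContinuousLinearMap.fst ℝ _ _).comp (ContinuousLinearMap.snd ℝ _ _)))
  have h3 := hexp (i₃.comp ((ContinuousLinearMap.snd ℝ _ _).comp (ContinuousLinearMap.snd ℝ _ _)))
  refine (h1.mul' (h2.mul' h3)).congr_fderiv ?_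
  ext p <;> simp

/-- If the orbit of `ξ₀` under the closed subgroup `H` has interior points, then the Lie algebra
of `H` maps `ξ₀` onto `V`. -/
theorem exists_mem_lieAlg_apply_eq [FiniteDimensional ℝ V] {ρ : 𝔸 →L[ℝ] V →L[ℝ] V}
    (hρ1 : ∀ v, ρ 1 v = v) (hρ : ∀ a b v, ρ (a * b) v = ρ b (ρ a v))
    {H : Subgroup 𝔸ˣ} (hH : IsClosed (H : Set 𝔸ˣ)) {ξ₀ : V}
    (hint : (interior {w | ∃ u ∈ H, ρ (u : 𝔸) ξ₀ = w}).Nonempty) (v : V) :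
    ∃ X ∈ lieAlg H hH, ρ X ξ₀ = v := by
  set L : 𝔸 →L[ℝ] V := (ContinuousLinearMap.apply ℝ V ξ₀).comp ρ with hL
  set ev : lieAlg H hH →ₗ[ℝ] V := (L : 𝔸 →ₗ[ℝ] V).comp (lieAlg H hH).subtype with hev
  by_contra hcon
  have hlt : Module.finrank ℝ ev.range < Module.finrank ℝ V := by
    refine Submodule.finrank_lt fun htop => hcon ?_
    obtain ⟨X, hX⟩ := LinearMap.range_eq_top.1 htop v
    exact ⟨X, X.2, hX⟩
  obtain ⟨σ, hσ⟩ := ev.rangeRestrict.exists_rightInverse_of_surjective ev.range_rangeRestrict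
  have hσ' : ∀ w, ev (σ w) = w := fun w => congrArg Subtype.val (LinearMap.congr_fun hσ w)
  obtain ⟨N, hN⟩ := (lieAlg H hH).exists_isCompl
  -- `S` is the infinitesimal stabiliser of `ξ₀`. With the section `σ` of the evaluation map, the
  -- algebra splits as `S ⊕ σ(range) ⊕ N`, and `Φ` gives coordinates near `1` adapted to this
  -- splitting.
  set S : Submodule ℝ 𝔸 := lieAlg H hH ⊓ (L : 𝔸 →ₗ[ℝ] V).ker with hS
  set i₁ : S →L[ℝ] 𝔸 := S.subtypeL with hi₁
  set i₂ : ev.range →L[ℝ] 𝔸 := LinearMap.toContinuousLinearMap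
    ((lieAlg H hH).subtype.comp σ) with hi₂
  set i₃ : N →L[ℝ] 𝔸 := N.subtypeL with hi₃
  set Φ : S × ev.range × N → 𝔸 := fun p =>
    exp (i₁ p.1) * (exp (i₂ p.2.1) * exp (i₃ p.2.2)) with hΦ
  have hder : HasStrictFDerivAt Φ (i₁.coprod (i₂.coprod i₃)) 0 :=
    hasStrictFDerivAt_exp_mul_exp_mul_exp i₁ i₂ i₃
  have hsurj : (i₁.coprod (i₂.coprod i₃)).range = ⊤ := by
    rw [LinearMap.range_eq_top]
    intro A
    obtain ⟨X, hX, Y, hY, rfl⟩ := Submodule.mem_sup.1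
      (show A ∈ lieAlg H hH ⊔ N by rw [hN.sup_eq_top]; trivial)
    refine ⟨(⟨X - σ ⟨ev ⟨X, hX⟩, LinearMap.mem_range_self _ _⟩, ?_⟩,
      ⟨ev ⟨X, hX⟩, LinearMap.mem_range_self _ _⟩, ⟨Y, hY⟩), ?_⟩
    · refine ⟨Submodule.sub_mem _ hX (Subtype.property _), ?_⟩
      rw [SetLike.mem_coe, LinearMap.mem_ker, map_sub]
      exact sub_eq_zero.2 (hσ' ⟨ev ⟨X, hX⟩, LinearMap.mem_range_self _ _⟩).symm
    · simp [hi₁, hi₂, hi₃, ← add_assoc]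
  have hmap := hder.map_nhds_eq_of_surj hsurj
  have hΦ0 : Φ 0 = 1 := by simp [hΦ]
  rw [hΦ0] at hmap
  set B : Set (S × ev.range × N) :=
    {p | (∃ u ∈ H, (u : 𝔸) = exp ((p.2.2 : N) : 𝔸)) → p.2.2 = 0} with hB
  have hBmem : B ∈ 𝓝 0 :=
    ((continuous_snd.comp continuous_snd).tendsto (0 : S × ev.range × N)).eventually
      (eventually_exp_mem_imp_eq_zero hH hN.disjoint)
  set U : Set H := {h | ((h : 𝔸ˣ) : 𝔸) ∈ Φ '' B} with hU
  have hUmem : U ∈ 𝓝 (1 : H) := by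
    have h1 : Φ '' B ∈ 𝓝 (1 : 𝔸) := hmap ▸ image_mem_map hBmem
    have h2 : Continuous fun h : H => ((h : 𝔸ˣ) : 𝔸) :=
      Units.continuous_val.comp continuous_subtype_val
    exact h2.continuousAt.preimage_mem_nhds (by simpa using h1)
  set g : ev.range → V := fun w => L (exp (i₂ w)) with hg
  -- Smooth maps do not raise Hausdorff dimension, so this piece of the orbit is too small to have
  -- interior if the evaluation is not onto.
  have hgdim : dimH (Set.range g) ≤ Module.finrank ℝ ev.range := by
    refine ContDiff.dimH_range_le (L.contDiff.comp (ContDiff.comp ?_ i₂.contDiff))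
    exact contDiff_iff_contDiffAt.2 fun x => (exp_analytic (𝕂 := ℝ) x).contDiffAt
  have hUg : ∀ h ∈ U, ρ ((h : 𝔸ˣ) : 𝔸) ξ₀ ∈ Set.range g := by
    rintro h ⟨p, hp, hph⟩
    obtain ⟨a, ha, hae⟩ := exists_exp_of_mem_lieAlg p.1.2.1
    obtain ⟨b, hb, hbe⟩ := exists_exp_of_mem_lieAlg (σ p.2.1).2
    -- The first two factors lie in `H`, hence so does the third, and the complement `N` meets `H`
    -- only trivially near `0`. The stabiliser factor acts first and fixes `ξ₀`, so only the middle
    -- coordinate moves it.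
    have hY : p.2.2 = 0 := by
      refine hp ⟨b⁻¹ * (a⁻¹ * h), H.mul_mem (H.inv_mem hb) (H.mul_mem (H.inv_mem ha) h.2), ?_⟩
      have h1 : ((h : 𝔸ˣ) : 𝔸) = a * (b * exp ((p.2.2 : N) : 𝔸)) := by
        rw [← hph, hae, hbe]; rfl
      simp [Units.val_mul, h1]
    have h2 : ((h : 𝔸ˣ) : 𝔸) = exp (i₁ p.1) * exp (i₂ p.2.1) := by
      rw [← hph, hΦ]; simp [hY]
    refine ⟨p.2.1, ?_⟩
    have hk : ρ (i₁ p.1) ξ₀ = 0 := p.1.2.2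
    rw [h2, hρ, exp_apply_of_apply_eq_zero hρ1 hρ hk]
    rfl
  have hsc : SecondCountableTopology 𝔸ˣ :=
    have : ProperSpace 𝔸 := FiniteDimensional.proper_real 𝔸
    Units.isOpenEmbedding_val.isEmbedding.secondCountableTopology
  have hscH : SecondCountableTopology H :=
    TopologicalSpace.Subtype.secondCountableTopology (H : Set 𝔸ˣ)
  -- Second countability covers `H` by countably many translates of `U`, so the entire orbit has
  -- dimension at most that of the range.
  obtain ⟨s, hs, hcov⟩ := TopologicalSpace.countable_cover_nhds
    (f := fun k : H => (fun h : H => h * k⁻¹) ⁻¹' U) fun k => by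
      refine (continuous_mul_const k⁻¹).continuousAt.preimage_mem_nhds ?_
      rwa [mul_inv_cancel]
  have hsub : {w | ∃ u ∈ H, ρ (u : 𝔸) ξ₀ = w} ⊆
      ⋃ k ∈ s, ρ ((k : 𝔸ˣ) : 𝔸) '' Set.range g := by
    rintro _ ⟨u, hu, rfl⟩
    have h1 : (⟨u, hu⟩ : H) ∈ ⋃ k ∈ s, (fun h : H => h * k⁻¹) ⁻¹' U := hcov ▸ trivial
    simp only [Set.mem_iUnion] at h1 ⊢
    obtain ⟨k, hk, hkU⟩ := h1
    refine ⟨k, hk, _, hUg _ hkU, ?_⟩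
    rw [← hρ, ← Units.val_mul, ← Subgroup.coe_mul, inv_mul_cancel_right]
  have hdim : dimH {w | ∃ u ∈ H, ρ (u : 𝔸) ξ₀ = w} ≤ Module.finrank ℝ ev.range := by
    refine (dimH_mono hsub).trans ?_
    rw [dimH_bUnion hs]
    exact iSup₂_le fun k _ => ((ρ ((k : 𝔸ˣ) : 𝔸)).lipschitz.dimH_image_le _).trans hgdim
  rw [Real.dimH_of_nonempty_interior hint] at hdim
  exact absurd (by exact_mod_cast hdim) hlt.not_ge

end ClosedSubgroup

end Wavelet

/-! ### A polynomial vanishing off the orbit, and part 2 of the theorem. -/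

namespace Wavelet

open Filter Topology

variable {d : ℕ}

/-- Each group element acts by a homeomorphism preserving the orbit, so an interior point at `η` is
carried to every other point. -/
theorem isOpen_dualOrbit_of_mem_nhds {H : Subgroup (GL (Fin d) ℝ)} {η : E d}
    (h : Set.range (fun h : H => dualAct (h : GL (Fin d) ℝ) η) ∈ 𝓝 η) :
    IsOpen (Set.range (fun h : H => dualAct (h : GL (Fin d) ℝ) η)) := by
  set U := Set.range (fun h : H => dualAct (h : GL (Fin d) ℝ) η) with hU
  have h1 : U = ⋃ k : H, dualAct (k : GL (Fin d) ℝ) ⁻¹' interior U := by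
    refine Set.Subset.antisymm ?_ ?_
    · rintro _ ⟨k, rfl⟩
      refine Set.mem_iUnion.2 ⟨k⁻¹, ?_⟩
      rw [Set.mem_preimage, Subgroup.coe_inv, ← dualAct_mul, mul_inv_cancel, dualAct_one]
      exact mem_interior_iff_mem_nhds.2 h
    · refine Set.iUnion_subset fun k ξ hξ => ?_
      obtain ⟨u, hu⟩ := interior_subset hξ
      refine ⟨u * k⁻¹, ?_⟩
      simp only [Subgroup.coe_mul, Subgroup.coe_inv] at hu ⊢
      rw [dualAct_mul, hu, ← dualAct_mul, mul_inv_cancel, dualAct_one]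
  rw [h1]
  exact isOpen_iUnion fun k => isOpen_interior.preimage (continuous_dualAct _)

theorem IsOpenDualOrbit.eq_range {H : Subgroup (GL (Fin d) ℝ)} {O : Set (E d)}
    (hO : IsOpenDualOrbit H O) {ξ₀ : E d} (hξ₀ : ξ₀ ∈ O) :
    O = Set.range (fun h : H => dualAct (h : GL (Fin d) ℝ) ξ₀) := by
  obtain ⟨-, η, rfl⟩ := hO
  obtain ⟨a, rfl⟩ := hξ₀
  ext ξ
  constructor
  · rintro ⟨u, rfl⟩
    refine ⟨a⁻¹ * u, ?_⟩
    simp only [Subgroup.coe_mul, Subgroup.coe_inv]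
    rw [← dualAct_mul, mul_inv_cancel_left]
  · rintro ⟨u, rfl⟩
    exact ⟨a * u, by simp [dualAct_mul]⟩

section LieAlgebra

attribute [local instance] Matrix.linftyOpNormedRing Matrix.linftyOpNormedAlgebra

/-- The transposed action of matrices on `ℝ^d` as a continuous linear map. -/
noncomputable def transposeAct :
    Matrix (Fin d) (Fin d) ℝ →L[ℝ] E d →L[ℝ] E d :=
  LinearMap.toContinuousLinearMap
    { toFun := fun A => LinearMap.toContinuousLinearMap (Matrix.toEuclideanLin Aᵀ)
      map_add' := fun A B => by simp
      map_smul' := fun c A => by simp }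

theorem transposeAct_apply (A : Matrix (Fin d) (Fin d) ℝ) (v : E d) :
    transposeAct A v = act Aᵀ v := rfl

/-- There are matrices `X₁, …, X_d` such that `X₁ᵀ ξ₀, …, X_dᵀ ξ₀` is the standard basis, and
such that the vectors `X₁ᵀ η, …, X_dᵀ η` are linearly dependent for `η ∉ O`. -/
theorem IsOpenDualOrbit.exists_matrices (hd : 0 < d) {H : Subgroup (GL (Fin d) ℝ)}
    (hcl : IsClosed (H : Set (GL (Fin d) ℝ))) (hirr : IsIrreducibleRep H)
    {O : Set (E d)} (hO : IsOpenDualOrbit H O) {ξ₀ : E d} (hξ₀ : ξ₀ ∈ O) :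
    ∃ X : Fin d → Matrix (Fin d) (Fin d) ℝ,
      (Matrix.of fun i j => act (X i)ᵀ ξ₀ j).det ≠ 0 ∧
      ∀ η ∈ Oᶜ, (Matrix.of fun i j => act (X i)ᵀ η j).det = 0 := by
  have hne : Nonempty (Fin d) := ⟨⟨0, hd⟩⟩
  have hn1 : NormOneClass (Matrix (Fin d) (Fin d) ℝ) := Matrix.linfty_opNormOneClass
  have hρ1 : ∀ v : E d, transposeAct 1 v = v := fun v => by
    rw [transposeAct_apply, Matrix.transpose_one, act_one]
  have hρ : ∀ (a b : Matrix (Fin d) (Fin d) ℝ) (v : E d),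
      transposeAct (a * b) v = transposeAct b (transposeAct a v) := fun a b v => by
    simp only [transposeAct_apply, Matrix.transpose_mul, act_mul]
  have horb : ∀ η : E d, {w | ∃ u ∈ H, transposeAct (u : Matrix (Fin d) (Fin d) ℝ) η = w} =
      Set.range (fun h : H => dualAct (h : GL (Fin d) ℝ) η) := fun η => by
    ext w
    exact ⟨fun ⟨u, hu, hw⟩ => ⟨⟨u, hu⟩, hw⟩, fun ⟨u, hw⟩ => ⟨u, u.2, hw⟩⟩
  have hint : (interior {w | ∃ u ∈ H,
      transposeAct (u : Matrix (Fin d) (Fin d) ℝ) ξ₀ = w}).Nonempty := by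
    rw [horb, ← hO.eq_range hξ₀, hO.1.interior_eq]
    exact ⟨ξ₀, hξ₀⟩
  choose X hX hXe using fun i : Fin d =>
    exists_mem_lieAlg_apply_eq hρ1 hρ hcl hint (EuclideanSpace.single i (1 : ℝ))
  refine ⟨X, ?_, fun η hη => ?_⟩
  · have h1 : (Matrix.of fun i j => act (X i)ᵀ ξ₀ j) = 1 := by
      ext i j
      have h2 : act (X i)ᵀ ξ₀ j = (EuclideanSpace.single i (1 : ℝ) : E d) j :=
        congrArg (fun v : E d => v j) (hXe i)
      rw [Matrix.of_apply, h2, Matrix.one_apply, PiLp.single_apply]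
      simp [eq_comm]
    rw [h1, Matrix.det_one]
    exact one_ne_zero
  · by_contra hdet
    set M : Matrix (Fin d) (Fin d) ℝ := Matrix.of fun i j => act (X i)ᵀ η j with hM
    -- Nonzero determinant means that the `X_iᵀ η` span, so the Lie algebra maps `η` onto
    -- everything, the orbit of `η` is open, and it is contained in `O`, contrary to `η ∈ Oᶜ`.
    have hsurj : ∀ v : E d, ∃ Y ∈ lieAlg H hcl, transposeAct Y η = v := by
      intro v
      set c : Fin d → ℝ := WithLp.ofLp v ᵥ* M⁻¹ with hc
      refine ⟨∑ i, c i • X i, Submodule.sum_mem _ fun i _ => Submodule.smul_mem _ _ (hX i), ?_⟩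
      have h2 : c ᵥ* M = WithLp.ofLp v := by
        rw [hc, Matrix.vecMul_vecMul, Matrix.nonsing_inv_mul _ (isUnit_iff_ne_zero.2 hdet), Matrix.vecMul_one]
      ext j
      rw [← congrFun h2 j, map_sum]
      simp [Matrix.vecMul, dotProduct, hM, transposeAct_apply]
    have h3 : Set.range (fun h : H => dualAct (h : GL (Fin d) ℝ) η) ∈ 𝓝 η :=
      Filter.mem_of_superset (orbit_mem_nhds hρ1 hcl hsurj) (horb η).le
    have hU : IsOpenDualOrbit H (Set.range (fun h : H => dualAct (h : GL (Fin d) ℝ) η)) :=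
      ⟨isOpen_dualOrbit_of_mem_nhds h3, η, rfl⟩
    have hsub := hU.subset hirr hO.isDualInvariant hO.1 hO.nonempty
    exact hη (hsub ⟨1, by simp [dualAct_one]⟩)

end LieAlgebra

/-! ### Polynomials -/

/-- Polynomial functions on `ℝ^d`. -/
noncomputable def polyFun (d : ℕ) : Subalgebra ℂ (E d → ℂ) :=
  Algebra.adjoin ℂ (Set.range fun (j : Fin d) (ξ : E d) => ((ξ j : ℝ) : ℂ))

theorem coord_mem_polyFun (j : Fin d) : (fun ξ : E d => ((ξ j : ℝ) : ℂ)) ∈ polyFun d :=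
  Algebra.subset_adjoin ⟨j, rfl⟩

theorem act_coord_mem_polyFun (A : Matrix (Fin d) (Fin d) ℝ) (j : Fin d) :
    (fun ξ : E d => ((act A ξ j : ℝ) : ℂ)) ∈ polyFun d := by
  have h1 : (fun ξ : E d => ((act A ξ j : ℝ) : ℂ)) =
      ∑ k, (A j k : ℂ) • fun ξ : E d => ((ξ k : ℝ) : ℂ) := by
    funext ξ
    simp [act, Matrix.toLpLin_apply, Matrix.mulVec, dotProduct, Finset.sum_apply]
  rw [h1]
  exact Subalgebra.sum_mem _ fun k _ => Subalgebra.smul_mem _ (coord_mem_polyFun k) _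

theorem det_mem_polyFun (X : Fin d → Matrix (Fin d) (Fin d) ℝ) :
    (fun ξ : E d => (((Matrix.of fun i j => act (X i)ᵀ ξ j).det : ℝ) : ℂ)) ∈ polyFun d := by
  have h1 : (fun ξ : E d => (((Matrix.of fun i j => act (X i)ᵀ ξ j).det : ℝ) : ℂ)) =
      ∑ σ : Equiv.Perm (Fin d), ((Equiv.Perm.sign σ : ℤ) : ℂ) •
        ∏ i, fun ξ : E d => ((act (X (σ i))ᵀ ξ i : ℝ) : ℂ) := by
    funext ξ
    simp [Matrix.det_apply', Finset.sum_apply, Finset.prod_apply]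
  rw [h1]
  exact Subalgebra.sum_mem _ fun σ _ => Subalgebra.smul_mem _
    (Subalgebra.prod_mem _ fun i _ => act_coord_mem_polyFun _ _) _

/-- Multiplication of the Fourier transform by a polynomial corresponds to a differential
operator, which preserves `C_c^∞`. -/
theorem exists_fourier_eq_mul {q : E d → ℂ} (hq : q ∈ polyFun d) : ∀ {φ : E d → ℂ},
    ContDiff ℝ ∞ φ → HasCompactSupport φ → ∃ φ' : E d → ℂ, ContDiff ℝ ∞ φ' ∧
      HasCompactSupport φ' ∧ ∀ ξ, 𝓕 φ' ξ = q ξ * 𝓕 φ ξ := by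
  have hint : ∀ {φ : E d → ℂ}, ContDiff ℝ ∞ φ → HasCompactSupport φ → Integrable φ volume :=
    fun h1 h2 => h1.continuous.integrable_of_hasCompactSupport h2
  have hmul : ∀ (r : ℂ) (φ : E d → ℂ) (ξ : E d), 𝓕 (fun x => r * φ x) ξ = r * 𝓕 φ ξ := by
    intro r φ ξ
    rw [Real.fourier_eq, Real.fourier_eq, ← integral_const_mul]
    simp only [mul_smul_comm]
  induction hq using Algebra.adjoin_induction with
  | mem q hq =>
    obtain ⟨j, rfl⟩ := hq
    intro φ hφ hc
    have h1 := SchwartzMap.fourier_lineDerivOp_eq (hc.toSchwartzMap hφ)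
      (EuclideanSpace.single j (1 : ℝ))
    have hg : Function.HasTemperateGrowth
        (fun ξ : E d => inner ℝ ξ (EuclideanSpace.single j (1 : ℝ))) := by fun_prop
    refine ⟨fun x => (2 * Real.pi * Complex.I)⁻¹ *
      fderiv ℝ φ x (EuclideanSpace.single j (1 : ℝ)), ?_, ?_, fun ξ => ?_⟩
    · exact contDiff_const.mul ((hφ.fderiv_right (m := ∞) (by simp)).clm_apply contDiff_const)
    · exact (hc.fderiv_apply (𝕜 := ℝ) _).mul_left
    · have h2 := congrArg (fun F : SchwartzMap (E d) ℂ => F ξ) h1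
      have h3 : 𝓕 (fun x => fderiv ℝ φ x (EuclideanSpace.single j (1 : ℝ))) ξ =
          (2 * Real.pi * Complex.I) * (((ξ j : ℝ) : ℂ) * 𝓕 φ ξ) := by
        rw [_root_.smul_apply, SchwartzMap.smulLeftCLM_apply_apply hg,
          EuclideanSpace.inner_single_right, one_mul] at h2
        exact h2
      rw [hmul, h3, inv_mul_cancel_left₀ Complex.two_pi_I_ne_zero]
  | algebraMap r =>
    intro φ hφ hc
    refine ⟨fun x => r * φ x, contDiff_const.mul hφ, hc.mul_left, fun ξ => ?_⟩
    rw [hmul]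
    rfl
  | add p q _ _ hp hq =>
    intro φ hφ hc
    obtain ⟨φ₁, h1, h1c, h1F⟩ := hp hφ hc
    obtain ⟨φ₂, h2, h2c, h2F⟩ := hq hφ hc
    refine ⟨φ₁ + φ₂, h1.add h2, h1c.add h2c, fun ξ => ?_⟩
    have : 𝓕 (φ₁ + φ₂) ξ = 𝓕 φ₁ ξ + 𝓕 φ₂ ξ := by
      simp only [Real.fourier_eq, Pi.add_apply, smul_add]
      exact integral_add ((Real.fourierIntegral_convergent_iff ξ).2 (hint h1 h1c))
        ((Real.fourierIntegral_convergent_iff ξ).2 (hint h2 h2c))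
    rw [this, h1F, h2F, Pi.add_apply, add_mul]
  | mul p q _ _ hp hq =>
    intro φ hφ hc
    obtain ⟨φ₁, h1, h1c, h1F⟩ := hq hφ hc
    obtain ⟨φ₂, h2, h2c, h2F⟩ := hp h1 h1c
    exact ⟨φ₂, h2, h2c, fun ξ => by rw [h2F, h1F, Pi.mul_apply, mul_assoc]⟩

/-- Polynomials have polynomial growth and polynomially growing local Lipschitz constants. -/
theorem exists_polyFun_bound {q : E d → ℂ} (hq : q ∈ polyFun d) : ∃ (K : ℝ) (N : ℕ), 0 ≤ K ∧
    ∀ R : ℝ, 1 ≤ R → ∀ ξ η : E d, ‖ξ‖ ≤ R → ‖η‖ ≤ R →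
      ‖q ξ‖ ≤ K * R ^ N ∧ ‖q ξ - q η‖ ≤ K * R ^ N * ‖ξ - η‖ := by
  induction hq using Algebra.adjoin_induction with
  | mem q hq =>
    obtain ⟨j, rfl⟩ := hq
    refine ⟨1, 1, zero_le_one, fun R hR ξ η hξ hη => ?_⟩
    simp only [pow_one, one_mul, ← Complex.ofReal_sub, Complex.norm_real]
    refine ⟨(PiLp.norm_apply_le ξ j).trans hξ, ?_⟩
    exact (PiLp.norm_apply_le (ξ - η) j).trans (le_mul_of_one_le_left (norm_nonneg _) hR)
  | algebraMap r =>
    refine ⟨‖r‖, 0, norm_nonneg _, fun R hR ξ η hξ hη => ?_⟩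
    simp only [Pi.algebraMap_apply, Algebra.algebraMap_self, RingHom.id_apply, pow_zero, mul_one,
      sub_self, norm_zero, le_refl, true_and]
    positivity
  | add p q _ _ hp hq =>
    obtain ⟨K₁, N₁, hK₁, h1⟩ := hp
    obtain ⟨K₂, N₂, hK₂, h2⟩ := hq
    refine ⟨K₁ + K₂, N₁ + N₂, add_nonneg hK₁ hK₂, fun R hR ξ η hξ hη => ?_⟩
    have hb1 : K₁ * R ^ N₁ ≤ K₁ * R ^ (N₁ + N₂) := by gcongr; exact Nat.le_add_right _ _
    have hb2 : K₂ * R ^ N₂ ≤ K₂ * R ^ (N₁ + N₂) := by gcongr; exact Nat.le_add_left _ _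
    obtain ⟨h1a, h1b⟩ := h1 R hR ξ η hξ hη
    obtain ⟨h2a, h2b⟩ := h2 R hR ξ η hξ hη
    refine ⟨?_, ?_⟩
    · rw [add_mul]
      exact (norm_add_le _ _).trans (add_le_add (h1a.trans hb1) (h2a.trans hb2))
    · rw [Pi.add_apply, Pi.add_apply, add_sub_add_comm, add_mul, add_mul]
      exact (norm_add_le _ _).trans (add_le_add
        (h1b.trans (mul_le_mul_of_nonneg_right hb1 (norm_nonneg _)))
        (h2b.trans (mul_le_mul_of_nonneg_right hb2 (norm_nonneg _))))
  | mul p q _ _ hp hq =>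
    obtain ⟨K₁, N₁, hK₁, h1⟩ := hp
    obtain ⟨K₂, N₂, hK₂, h2⟩ := hq
    refine ⟨2 * (K₁ * K₂), N₁ + N₂, by positivity, fun R hR ξ η hξ hη => ?_⟩
    have hR0 : 0 ≤ R := by linarith
    obtain ⟨h1a, h1b⟩ := h1 R hR ξ η hξ hη
    obtain ⟨h2a, h2b⟩ := h2 R hR ξ η hξ hη
    obtain ⟨h2c, -⟩ := h2 R hR η ξ hη hξ
    refine ⟨?_, ?_⟩
    · rw [Pi.mul_apply, norm_mul]
      calc ‖p ξ‖ * ‖q ξ‖ ≤ (K₁ * R ^ N₁) * (K₂ * R ^ N₂) := by gcongr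
        _ = K₁ * K₂ * R ^ (N₁ + N₂) := by ring
        _ ≤ 2 * (K₁ * K₂) * R ^ (N₁ + N₂) :=
          mul_le_mul_of_nonneg_right (by linarith [mul_nonneg hK₁ hK₂]) (by positivity)
    · have h3 : (p * q) ξ - (p * q) η = p ξ * (q ξ - q η) + (p ξ - p η) * q η := by
        simp only [Pi.mul_apply]; ring
      rw [h3]
      refine (norm_add_le _ _).trans ?_
      rw [norm_mul, norm_mul]
      calc ‖p ξ‖ * ‖q ξ - q η‖ + ‖p ξ - p η‖ * ‖q η‖
          ≤ (K₁ * R ^ N₁) * (K₂ * R ^ N₂ * ‖ξ - η‖) +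
            (K₁ * R ^ N₁ * ‖ξ - η‖) * (K₂ * R ^ N₂) := by gcongr
        _ = 2 * (K₁ * K₂) * R ^ (N₁ + N₂) * ‖ξ - η‖ := by ring

theorem infDist_le_norm {C : Set (E d)} (h0 : (0 : E d) ∈ C) (ξ : E d) :
    Metric.infDist ξ C ≤ ‖ξ‖ := by
  simpa using Metric.infDist_le_dist_of_mem (x := ξ) h0

/-- Since `dist ≤ |ξ|`, dividing the distance by `(1 + |ξ|)²` puts it below both terms of the
minimum. The lost powers of `1 + |ξ|` are later absorbed by a Schwartz function. -/
theorem infDist_le_auxA_mul {O : Set (E d)} (h0 : (0 : E d) ∈ Oᶜ) (ξ : E d) :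
    Metric.infDist ξ Oᶜ ≤ auxA O ξ * (1 + ‖ξ‖) ^ 2 := by
  have h1 := infDist_le_norm h0 ξ
  have h2 : 0 ≤ Metric.infDist ξ Oᶜ := Metric.infDist_nonneg
  have hn : 0 ≤ ‖ξ‖ := norm_nonneg ξ
  rw [← div_le_iff₀ (by positivity), auxA]
  refine le_min ?_ ?_
  · refine div_le_div_of_nonneg_left h2 (by positivity) ?_
    have h3 : Real.sqrt (‖ξ‖ ^ 2 - Metric.infDist ξ Oᶜ ^ 2) ≤ ‖ξ‖ :=
      Real.sqrt_le_iff.2 ⟨hn, by nlinarith⟩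
    nlinarith
  · rw [div_le_div_iff₀ (by positivity) (by positivity)]
    nlinarith

/-- A polynomial vanishing on the complement of `O` is dominated by `A` times a power of
`1 + |ξ|`. -/
theorem exists_norm_polyFun_le_auxA {O : Set (E d)} (hO : IsOpen O) (h0 : (0 : E d) ∈ Oᶜ)
    {q : E d → ℂ} (hq : q ∈ polyFun d) (hq0 : ∀ η ∈ Oᶜ, q η = 0) : ∃ (K : ℝ) (N : ℕ), 0 ≤ K ∧
      ∀ ξ, ‖q ξ‖ ≤ K * (1 + ‖ξ‖) ^ N * auxA O ξ := by
  obtain ⟨K, N, hK, hb⟩ := exists_polyFun_bound hq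
  refine ⟨K * 2 ^ N, N + 2, by positivity, fun ξ => ?_⟩
  obtain ⟨η, hη, hdist⟩ := hO.isClosed_compl.exists_infDist_eq_dist ⟨0, h0⟩ ξ
  have hn : 0 ≤ ‖ξ‖ := norm_nonneg ξ
  have h1 : ‖ξ - η‖ ≤ ‖ξ‖ := by
    rw [← dist_eq_norm, ← hdist]; exact infDist_le_norm h0 ξ
  have h2 : ‖η‖ ≤ 2 * (1 + ‖ξ‖) := by
    have := norm_sub_norm_le η ξ
    rw [norm_sub_rev] at this
    linarith
  have h3 := (hb (2 * (1 + ‖ξ‖)) (by linarith) ξ η (by linarith) h2).2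
  rw [hq0 η hη, sub_zero, ← dist_eq_norm, ← hdist] at h3
  refine h3.trans ?_
  calc K * (2 * (1 + ‖ξ‖)) ^ N * Metric.infDist ξ Oᶜ
      ≤ K * (2 * (1 + ‖ξ‖)) ^ N * (auxA O ξ * (1 + ‖ξ‖) ^ 2) := by
        gcongr; exact infDist_le_auxA_mul h0 ξ
    _ = K * 2 ^ N * (1 + ‖ξ‖) ^ (N + 2) * auxA O ξ := by rw [mul_pow]; ring

/-- There are admissible vectors in `C_c^∞`. -/
theorem exists_contDiff_hasCompactSupport_isAdmissibleFun (hd : 0 < d)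
    {H : Subgroup (GL (Fin d) ℝ)} [MeasurableSpace H] [BorelSpace H] {μ : Measure H}
    [μ.IsHaarMeasure] (hH : IsAdmissibleDilationGroup H μ) {O : Set (E d)}
    (hO : IsOpenDualOrbit H O) {ℓ : ℕ} (hℓ : TemperatelyEmbedded H μ O 0 2 (fun _ => 1) ℓ) :
    ∃ ψ : E d → ℂ, ContDiff ℝ ∞ ψ ∧ HasCompactSupport ψ ∧ IsAdmissibleFun H μ ψ := by
  let ρ : ContDiffBump (0 : E d) := ⟨1, 2, zero_lt_one, one_lt_two⟩
  set φ : E d → ℂ := fun x => ((ρ.normed volume x : ℝ) : ℂ) with hφdef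
  have hφ : ContDiff ℝ ∞ φ := Complex.ofRealCLM.contDiff.comp ρ.contDiff_normed
  have hφc : HasCompactSupport φ := ρ.hasCompactSupport_normed.comp_left Complex.ofReal_zero
  have hφint : Integrable φ volume := hφ.continuous.integrable_of_hasCompactSupport hφc
  have hφ0 : 𝓕 φ 0 = 1 := by
    rw [Real.fourier_eq]
    simp only [inner_zero_right, neg_zero, AddChar.map_zero_eq_one, one_smul, hφdef]
    rw [integral_complex_ofReal, ρ.integral_normed, Complex.ofReal_one]
  obtain ⟨ξ₁, hξ₁, hfin⟩ := hℓ.exists_lintegral_lt_top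
  -- `φ^` is continuous with `φ^(0) = 1`, and shrinking `ξ₁` along its ray stays in `O`; this makes
  -- `ψ^ = q^ℓ φ^` nonzero at some point.
  obtain ⟨ξ₀, hξ₀, hφξ₀⟩ : ∃ ξ₀ ∈ O, 𝓕 φ ξ₀ ≠ 0 := by
    have h1 : Tendsto (fun c : ℝ => 𝓕 φ (c • ξ₁)) (𝓝[≠] 0) (𝓝 (𝓕 φ 0)) := by
      refine Tendsto.mono_left ?_ nhdsWithin_le_nhds
      have h2 : Continuous fun c : ℝ => 𝓕 φ (c • ξ₁) :=
        (continuous_fourier hφint).comp (continuous_id.smul continuous_const)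
      simpa using h2.tendsto 0
    rw [hφ0] at h1
    obtain ⟨c, hc, hc0⟩ :=
      ((h1.eventually_ne one_ne_zero).and eventually_mem_nhdsWithin).exists
    exact ⟨c • ξ₁, hO.smul_mem hH.irreducible hc0 hξ₁, hc⟩
  obtain ⟨X, hX0, hXO⟩ := hO.exists_matrices hd hH.closed hH.irreducible hξ₀
  set q : E d → ℂ := fun ξ => (((Matrix.of fun i j => act (X i)ᵀ ξ j).det : ℝ) : ℂ) with hqdef
  have hq : q ∈ polyFun d := det_mem_polyFun X
  obtain ⟨K, N, hK, hqb⟩ := exists_norm_polyFun_le_auxA hO.1 (hO.zero_notMem hd) hq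
    fun η hη => by rw [hqdef]; simp only [hXO η hη, Complex.ofReal_zero]
  obtain ⟨ψ, hψ, hψc, hψF⟩ := exists_fourier_eq_mul (Subalgebra.pow_mem _ hq ℓ) hφ hφc
  have hψint : Integrable ψ volume := hψ.continuous.integrable_of_hasCompactSupport hψc
  refine ⟨ψ, hψ, hψc, isAdmissibleFun_of_lintegral_lt_top hH hO hξ₁ hψint
    (hψ.continuous.memLp_of_hasCompactSupport hψc) (fun h0 => ?_)
    (hfin _ (K ^ ℓ * (2 ^ (N * ℓ) * ((Finset.Iic (N * ℓ, 0)).sup fun m =>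
      SchwartzMap.seminorm ℝ m.1 m.2) (𝓕 (hφc.toSchwartzMap hφ)))) fun ξ => ?_)⟩
  · have h1 : 𝓕 ψ ξ₀ = 0 := by
      rw [Real.fourier_eq]
      refine integral_eq_zero_of_ae ?_
      filter_upwards [h0] with x hx
      simp [hx]
    rw [hψF] at h1
    refine mul_ne_zero (pow_ne_zero ℓ ?_) hφξ₀ h1
    exact Complex.ofReal_ne_zero.2 hX0
  · have hS := SchwartzMap.one_add_le_sup_seminorm_apply (𝕜 := ℝ) (m := (N * ℓ, 0)) le_rfl le_rfl
      (𝓕 (hφc.toSchwartzMap hφ)) ξ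
    rw [norm_iteratedFDeriv_zero] at hS
    have hFS : (𝓕 (hφc.toSchwartzMap hφ)) ξ = 𝓕 φ ξ := rfl
    rw [hFS] at hS
    rw [hψF, norm_mul, Pi.pow_apply, norm_pow]
    have hA := auxA_nonneg O ξ
    calc ‖q ξ‖ ^ ℓ * ‖𝓕 φ ξ‖ ≤ (K * (1 + ‖ξ‖) ^ N * auxA O ξ) ^ ℓ * ‖𝓕 φ ξ‖ := by
          gcongr; exact hqb ξ
      _ = K ^ ℓ * ((1 + ‖ξ‖) ^ (N * ℓ) * ‖𝓕 φ ξ‖) * auxA O ξ ^ ℓ := by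
          rw [mul_pow, mul_pow, ← pow_mul]; ring
      _ ≤ _ := by gcongr

end Wavelet

theorem corollary4p2 {d : ℕ} (hd : 0 < d) (H : Subgroup (Matrix.GeneralLinearGroup (Fin d) ℝ))
    [MeasurableSpace H] [BorelSpace H] (μ : MeasureTheory.Measure H) [μ.IsHaarMeasure]
    (hH : Wavelet.IsAdmissibleDilationGroup H μ)
    (O : Set (Wavelet.E d)) (hO : Wavelet.IsOpenDualOrbit H O) (ℓ : ℕ)
    (hℓ : Wavelet.TemperatelyEmbedded H μ O 0 2 (fun _ => 1) ℓ) :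
    (∀ (t : ℕ) (ψ : Wavelet.E d → ℂ), (ℓ : ℝ) + d / 2 + 1 < t →
      Wavelet.HasVanishingMoments O t ψ →
      Wavelet.schwartzNorm t t (𝓕 ψ) < ⊤ →
      ¬ (ψ =ᵐ[MeasureTheory.volume] 0) →
      Wavelet.IsAdmissibleFun H μ ψ) ∧
    ∃ ψ : Wavelet.E d → ℂ, ContDiff ℝ ∞ ψ ∧ HasCompactSupport ψ ∧
      Wavelet.IsAdmissibleFun H μ ψ := by
  exact ⟨fun t ψ ht hψ hS hne =>
    Wavelet.isAdmissibleFun_of_hasVanishingMoments hd hH hO hℓ ht hψ hS hne,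
    Wavelet.exists_contDiff_hasCompactSupport_isAdmissibleFun hd hH hO hℓ⟩
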